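/- **Setting.** For real $t,u,v$ put $a_t=\begin{pmatrix}e^{t/2}&0\\0&e^{-t/2}\end{pmatrix}$, $n_u=\begin{pmatrix}1&u\\0&1\end{pmatrix}$, $n^-_v=\begin{pmatrix}1&0\\v&1\end{pmatrix}$, and let $g_t(x)=xa_t$, $h^+_u(x)=xn_u$, $h^-_v(x)=xn^-_v$ be the geodesic, unstable horocycle and stable horocycle flows on $\mathrm{SL}(2,\mathbb R)$. Let $M=\mathrm{PSL}(2,\mathbb Z)\backslash \mathrm{PSL}(2,\mathbb R)=\mathrm{SL}(2,\mathbb Z)\backslash \mathrm{SL}(2,\mathbb R)$ (the unit tangent bundle of the modular orbifold), to which the flows descend; let $P:\mathrm{SL}(2,\mathbb R)\to M$ be the projection, and let $\overline m$ be the Haar measure of $M$ normalized to be a probability measure. For $y>0$ let $m_y$ be the uniform probability measure (with respect to arc length) on the closed orbit $\{P(a_{\log y}n_s): 0\le s\le 1/y\}$ of $h^+$, which has period $1/y$. For $x\in \mathrm{SL}(2,\mathbb R)$ and $a,b,c>0$ the closed box with centre $x$ is $$C(x;a,b,c)=\{h^+_v(g_t(h^-_u(x))) : |v|\le a/2,\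 |t|\le b/2,\ |u|\le c/2\},$$ and its base is $\beta=\{g_t(h^-_u(x)) : |t|\le b/2,\ |u|\le c/2\}$. An *adapted box* in $M$ is a set $C=P(C(x;a,b,c))$ such that $P$ is injective on $C(x;a,b,c)$ (the box is embedded) and $P(\beta)$ is contained in the basic stable leaf $\{P(h^-_v(g_t(e))) : v,t\in\mathbb R\}$, where $e$ is the identity matrix. **Theorem 3.18.** Let $C\subset M$ be any adapted box. Then $$m_y(C)=\overline m(C)+K_C(y)\,y^{1/2}\log y ,$$ where $|K_C(y)|$ is bounded by some positive constant for all $0<y\le 1/2$. Furthermore, this constant can be chosen to be the same for every adapted box contained in $C$: there is $k>0$, depending only on $C$, such that every adapted box $C'\subseteq C$ satisfies $m_y(C')=\overline m(C')+K_{C'}(y)\,y^{1/2}\log y$ with $|K_{C'}(y)|\le k$ for all $0<y\le 1/2$. -/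

import Mathlib

open MeasureTheory
open scoped MatrixGroups

noncomputable section

namespace ModularHorocycle

/-- The Borel `σ`-algebra of `SL(2, ℝ)` (for its topology as a set of real matrices). -/
instance instMeasurableSpaceSL : MeasurableSpace SL(2, ℝ) := borel _

instance instBorelSpaceSL : BorelSpace SL(2, ℝ) := ⟨rfl⟩

instance instLocallyCompactSpaceMat : LocallyCompactSpace (Matrix (Fin 2) (Fin 2) ℝ) :=
  inferInstanceAs (LocallyCompactSpace (Fin 2 → Fin 2 → ℝ))

/-- `SL(2, ℝ)` is locally compact, being closed in the space of matrices. -/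
instance instLocallyCompactSpaceSL : LocallyCompactSpace SL(2, ℝ) :=
  (Matrix.SpecialLinearGroup.isClosedEmbedding_val (n := Fin 2) (R := ℝ)).locallyCompactSpace

/-! ### The three flows on `SL(2, ℝ)`, given by right multiplication by one-parameter subgroups -/

/-- The matrix `diag (e^{t/2}, e^{-t/2})`. -/
def diagMat (t : ℝ) : SL(2, ℝ) :=
  ⟨!![Real.exp (t / 2), 0; 0, Real.exp (-(t / 2))], by
    rw [Matrix.det_fin_two_of, ← Real.exp_add]; simp⟩

/-- The upper triangular unipotent matrix with upper right entry `u`. -/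
def upperMat (u : ℝ) : SL(2, ℝ) :=
  ⟨!![1, u; 0, 1], by rw [Matrix.det_fin_two_of]; simp⟩

/-- The lower triangular unipotent matrix with lower left entry `v`. -/
def lowerMat (v : ℝ) : SL(2, ℝ) :=
  ⟨!![1, 0; v, 1], by rw [Matrix.det_fin_two_of]; simp⟩

/-- The geodesic flow `g_t`. -/
def geodesicFlow (t : ℝ) (x : SL(2, ℝ)) : SL(2, ℝ) := x * diagMat t

/-- The unstable horocycle flow `h⁺_t`. -/
def unstableFlow (t : ℝ) (x : SL(2, ℝ)) : SL(2, ℝ) := x * upperMat t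

/-- The stable horocycle flow `h⁻_t`. -/
def stableFlow (t : ℝ) (x : SL(2, ℝ)) : SL(2, ℝ) := x * lowerMat t

/-! ### The space `M` -/

/-- `SL(2, ℤ)` as a subgroup of `SL(2, ℝ)`. -/
def modularSubgroup : Subgroup SL(2, ℝ) :=
  (Matrix.SpecialLinearGroup.map (n := Fin 2) (Int.castRingHom ℝ)).range

/-- The unit tangent bundle `M` of the modular orbifold: the orbit space of `SL(2, ℤ)` acting on
`SL(2, ℝ)` by left multiplication. Since `-1` lies in `SL(2, ℤ)`, this is the same as the quotient
of `PSL(2, ℝ)` by `PSL(2, ℤ)`. The flows above act on the right and descend to `M`. -/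
def ModularBundle : Type := MulAction.orbitRel.Quotient modularSubgroup SL(2, ℝ)

/-- The covering projection `SL(2, ℝ) → M`. -/
def proj (x : SL(2, ℝ)) : ModularBundle :=
  Quotient.mk (MulAction.orbitRel modularSubgroup SL(2, ℝ)) x

instance instTopologicalSpaceModularBundle : TopologicalSpace ModularBundle :=
  inferInstanceAs (TopologicalSpace (Quotient (MulAction.orbitRel modularSubgroup SL(2, ℝ))))

instance instMeasurableSpaceModularBundle : MeasurableSpace ModularBundle := borel _

instance instBorelSpaceModularBundle : BorelSpace ModularBundle := ⟨rfl⟩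

/-! ### The normalized Haar measure and the horocycle measures -/

/-- The matrices `x` for which `x • i` lies in the standard fundamental domain
`{|Re z| ≤ 1/2, |z| ≥ 1}` of the modular group. It meets almost every orbit of
`SL(2, ℤ)` in exactly two points, `x` and `-x`. -/
def fundDomain : Set SL(2, ℝ) := {x | x • UpperHalfPlane.I ∈ ModularGroup.fd}

/-- The Haar measure of `M`, normalized to be a probability measure: the Haar measure of `SL(2, ℝ)`,
restricted to a fundamental domain, normalized to total mass one there, and projected to `M`. -/
def haarProb : Measure ModularBundle :=
  (ProbabilityTheory.cond (Measure.haar : Measure SL(2, ℝ)) fundDomain).map proj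

/-- The measure `m_y`: the uniform probability measure on the closed orbit of `h⁺` of period
`1 / y`, which is the orbit of the class of `diag (y^{1/2}, y^{-1/2})`. -/
def horocycleMeasure (y : ℝ) : Measure ModularBundle :=
  ENNReal.ofReal y • (volume.restrict (Set.Icc (0 : ℝ) (1 / y))).map
    (fun t : ℝ => proj (unstableFlow t (diagMat (Real.log y))))

/-! ### Boxes -/

/-- The base of a box with centre `x`: a rectangle in the stable leaf through `x`, bounded by two
geodesic segments and two stable horocycle segments. -/
def boxBase (x : SL(2, ℝ)) (b c : ℝ) : Set SL(2, ℝ) :=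
  {p | ∃ u ∈ Set.Icc (-(c / 2)) (c / 2), ∃ t ∈ Set.Icc (-(b / 2)) (b / 2),
    p = geodesicFlow t (stableFlow u x)}

/-- The closed box `C(x; a, b, c)`: the union of the segments of unstable horocycle orbits of
length `a` whose midpoints are in the base. -/
def standardBox (x : SL(2, ℝ)) (a b c : ℝ) : Set SL(2, ℝ) :=
  {q | ∃ p ∈ boxBase x b c, ∃ v ∈ Set.Icc (-(a / 2)) (a / 2), q = unstableFlow v p}

/-- The basic stable leaf of `M`, the projection of the leaf `{h⁻_v (g_t e)}` through the identity.
It is the set of classes of upward vertical unit vectors, and the union of all closed orbits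
of `h⁻`. -/
def basicStableLeaf : Set ModularBundle :=
  {p | ∃ v t : ℝ, p = proj (stableFlow v (geodesicFlow t 1))}

/-- Adapted boxes of `M`: images of boxes of `SL(2, ℝ)` that are embedded in `M` by the projection
and whose base is contained in the basic stable leaf. -/
def IsAdaptedBox (C : Set ModularBundle) : Prop :=
  ∃ (x : SL(2, ℝ)) (a b c : ℝ), 0 < a ∧ 0 < b ∧ 0 < c ∧
    Set.InjOn proj (standardBox x a b c) ∧
    C = proj '' standardBox x a b c ∧
    proj '' boxBase x b c ⊆ basicStableLeaf

end ModularHorocycle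

end

open scoped ENNReal

noncomputable section

namespace ModularHorocycle

open Set

/-! Both sides are computed by looking at first columns. Membership of a matrix in a box splits into
a condition on its first column, which must lie in a plane trapezoid (`boxSector`), and a condition
placing the unstable coordinate in an interval of length `a` (`mem_standardBox_iff`). Along the
horocycle `t ↦ γ a_{log y} n_t` the first column is constantly `√y` times the first column `v` of
`γ`. A translate with `√y v` in the trapezoid therefore meets the box for a time exactly `a`, and
all other translates miss it. Integral matrices sharing the column `v` differ by powers of `T`,
which shift time by whole periods, so each primitive `v` contributes exactly `a` per period. Hence
`m_y(C)` equals `y a` times the number of primitive lattice points in the trapezoid dilated by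
`y^{-1/2}` (`horocycleMeasure_real_box`).

Counting unit cells that meet the boundary, followed by Möbius inversion, gives `(6/π²) T² area +
O(T log T)` primitive points in the dilate by `T` (`exists_abs_ncard_primitive_sub_le`). With `T =
y^{-1/2}` the error becomes `O(y^{1/2} |log y|)`.

The main term must be the Haar measure. Haar measure is realised, up to a factor, as Lebesgue volume
of cones in the space of 2×2 matrices. The cone over a box has volume `(a/2) area`, and the cone
over the fundamental domain has volume `π²/6`. Since `-1` makes almost every orbit meet the domain
twice, an embedded box has probability `a · area · 6/π²` (`haarProb_real_box`), which cancels the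
main term exactly.

For uniformity, the counting error depends only on a square containing the trapezoid. A box inside
`C` lifts to a box inside the lift of `C` (`exists_translate_standardBox_subset`), so its trapezoid
lies in the same square and its width is at most `a`. -/

/-! ### Lattice points in plane regions -/

/-- The point of the plane with given integer coordinates. -/
def latticePoint (v : ℤ × ℤ) : ℝ × ℝ := (v.1, v.2)

/-- The integer part, coordinate by coordinate, of a point of the plane. -/
def planeFloor (z : ℝ × ℝ) : ℤ × ℤ := (⌊z.1⌋, ⌊z.2⌋)

/-- The half-open unit square with lower left corner `v`. -/
def unitCell (v : ℤ × ℤ) : Set (ℝ × ℝ) := Ico (v.1 : ℝ) (v.1 + 1) ×ˢ Ico (v.2 : ℝ) (v.2 + 1)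

lemma mem_unitCell_iff {v : ℤ × ℤ} {z : ℝ × ℝ} : z ∈ unitCell v ↔ planeFloor z = v := by
  simp only [unitCell, planeFloor, mem_prod, mem_Ico, Prod.ext_iff, Int.floor_eq_iff]

lemma latticePoint_mem_unitCell (v : ℤ × ℤ) : latticePoint v ∈ unitCell v := by
  simp [mem_unitCell_iff, planeFloor, latticePoint]

lemma measurableSet_unitCell (v : ℤ × ℤ) : MeasurableSet (unitCell v) :=
  measurableSet_Ico.prod measurableSet_Ico

lemma isPreconnected_unitCell (v : ℤ × ℤ) : IsPreconnected (unitCell v) :=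
  ((convex_Ico _ _).prod (convex_Ico _ _)).isPreconnected

lemma volume_unitCell (v : ℤ × ℤ) : volume (unitCell v) = 1 := by
  rw [unitCell, Measure.volume_eq_prod, Measure.prod_prod]
  simp

/-- Cut the segment into `n` equal pieces. Each point differs by less than one in each coordinate
from a subdivision point, so its cell is among the 3 × 3 block around the cell of that point. -/
lemma exists_finset_planeFloor_segment (P Q : ℝ × ℝ) (n : ℕ) (hn : 0 < n)
    (h1 : |Q.1 - P.1| ≤ n) (h2 : |Q.2 - P.2| ≤ n) :
    ∃ s : Finset (ℤ × ℤ), s.card ≤ 9 * (n + 1) ∧ ∀ z ∈ segment ℝ P Q, planeFloor z ∈ s := by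
  classical
  have hn' : (0 : ℝ) < n := by exact_mod_cast hn
  set pt : ℕ → ℝ × ℝ := fun j => (P.1 + (j / n : ℝ) * (Q.1 - P.1), P.2 + (j / n : ℝ) * (Q.2 - P.2))
    with hpt
  refine ⟨(Finset.range (n + 1)).biUnion fun j =>
    Finset.Icc (⌊(pt j).1⌋ - 1) (⌊(pt j).1⌋ + 1) ×ˢ
      Finset.Icc (⌊(pt j).2⌋ - 1) (⌊(pt j).2⌋ + 1), ?_, ?_⟩
  · refine (Finset.card_biUnion_le_card_mul _ _ 9 fun j _ => ?_).trans ?_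
    · rw [Finset.card_product, Int.card_Icc, Int.card_Icc]
      have h (k : ℤ) : (k + 1 + 1 - (k - 1)).toNat = 3 := by
        rw [show k + 1 + 1 - (k - 1) = 3 by ring]; rfl
      rw [h, h]
    · rw [Finset.card_range, mul_comm]
  · rintro z ⟨a, t, ha, ht, hat, rfl⟩
    have hle : t ≤ 1 := by linarith
    have htn : 0 ≤ t * n := by positivity
    have hj1 := Nat.floor_le htn
    have hj2 := Nat.lt_floor_add_one (t * n)
    set j := ⌊t * (n : ℝ)⌋₊ with hj
    have hjn : j < n + 1 := by
      have : (j : ℝ) ≤ n := hj1.trans (by nlinarith)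
      have : j ≤ n := by exact_mod_cast this
      omega
    have hd0 : 0 ≤ t - j / n := by
      rw [sub_nonneg, div_le_iff₀ hn']; exact hj1
    have hd1 : (t - j / n) * n < 1 := by
      rw [sub_mul, div_mul_cancel₀ _ hn'.ne']; linarith
    have key : ∀ p q : ℝ, |q - p| ≤ n →
        ⌊a * p + t * q⌋ ∈ Finset.Icc (⌊p + (j / n : ℝ) * (q - p)⌋ - 1)
          (⌊p + (j / n : ℝ) * (q - p)⌋ + 1) := by
      intro p q hpq
      have e : a * p + t * q = p + (j / n : ℝ) * (q - p) + (t - j / n) * (q - p) := by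
        have : a = 1 - t := by linarith
        rw [this]; ring
      have hb : |(t - j / n) * (q - p)| < 1 := by
        rw [abs_mul, abs_of_nonneg hd0]
        exact (mul_le_mul_of_nonneg_left hpq hd0).trans_lt hd1
      rw [abs_lt] at hb
      rw [Finset.mem_Icc]
      have f1 := Int.floor_le (a * p + t * q)
      have f2 := Int.lt_floor_add_one (a * p + t * q)
      have g1 := Int.floor_le (p + (j / n : ℝ) * (q - p))
      have g2 := Int.lt_floor_add_one (p + (j / n : ℝ) * (q - p))
      constructor
      · have : ((⌊p + (j / n : ℝ) * (q - p)⌋ - 1 : ℤ) : ℝ) < ((⌊a * p + t * q⌋ + 1 : ℤ) : ℝ) := by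
          push_cast; linarith
        have := Int.cast_lt.1 this
        omega
      · have : ((⌊a * p + t * q⌋ : ℤ) : ℝ) < ((⌊p + (j / n : ℝ) * (q - p)⌋ + 1 + 1 : ℤ) : ℝ) := by
          push_cast; linarith
        have := Int.cast_lt.1 this
        omega
    refine Finset.mem_biUnion.2 ⟨j, Finset.mem_range.2 hjn, Finset.mem_product.2 ⟨?_, ?_⟩⟩
    · exact key P.1 Q.1 h1
    · exact key P.2 Q.2 h2

/-- A connected cell missing the frontier cannot be split by the disjoint open sets `interior K` and
`Kᶜ`. -/
lemma unitCell_subset_or_disjoint {K : Set (ℝ × ℝ)} (hK : IsClosed K) {v : ℤ × ℤ}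
    (hv : Disjoint (unitCell v) (frontier K)) : unitCell v ⊆ K ∨ Disjoint (unitCell v) K := by
  by_cases h : (unitCell v ∩ K).Nonempty
  · left
    have hcov : unitCell v ⊆ interior K ∪ Kᶜ := by
      intro z hz
      by_cases hzK : z ∈ K
      · left
        by_contra hi
        exact disjoint_left.1 hv hz ((hK.frontier_eq ▸ ⟨hzK, hi⟩ : z ∈ frontier K))
      · exact Or.inr hzK
    refine (IsPreconnected.subset_left_of_subset_union isOpen_interior hK.isOpen_compl
      (disjoint_compl_right.mono_left interior_subset) hcov ?_
      (isPreconnected_unitCell v)).trans interior_subset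
    obtain ⟨z, hz, hzK⟩ := h
    exact ⟨z, hz, (hcov hz).resolve_right (fun h => h hzK)⟩
  · right
    rwa [disjoint_iff_inter_eq_empty, ← not_nonempty_iff_eq_empty]

/-- Lattice point count in a closed plane region whose frontier is covered by four segments. -/
theorem abs_ncard_latticePoint_sub_area_le {K : Set (ℝ × ℝ)} (hK : IsClosed K) {ρ : ℝ}
    (hρ : ∀ z ∈ K, |z.1| ≤ ρ ∧ |z.2| ≤ ρ) (hρ0 : 0 ≤ ρ) (P Q : Fin 4 → ℝ × ℝ)
    (hP : ∀ i, |(P i).1| ≤ ρ ∧ |(P i).2| ≤ ρ) (hQ : ∀ i, |(Q i).1| ≤ ρ ∧ |(Q i).2| ≤ ρ)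
    (hfr : frontier K ⊆ ⋃ i, segment ℝ (P i) (Q i)) :
    {v : ℤ × ℤ | latticePoint v ∈ K}.Finite ∧
    |({v : ℤ × ℤ | latticePoint v ∈ K}.ncard : ℝ) - volume.real K| ≤ 144 * (ρ + 1) := by
  classical
  set n : ℕ := ⌊2 * ρ⌋₊ + 1 with hn
  have hn1 : 2 * ρ ≤ n := by
    rw [hn]; push_cast; exact (Nat.lt_floor_add_one _).le
  have hn2 : (n : ℝ) ≤ 2 * ρ + 1 := by
    rw [hn]; push_cast; linarith [Nat.floor_le (by positivity : 0 ≤ 2 * ρ)]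
  have hd : ∀ a b : ℝ, |a| ≤ ρ → |b| ≤ ρ → |a - b| ≤ n := fun a b ha hb =>
    ((abs_sub _ _).trans (add_le_add ha hb)).trans (by linarith)
  choose s hs hs' using fun i => exists_finset_planeFloor_segment (P i) (Q i) n (by omega)
    (hd _ _ (hQ i).1 (hP i).1) (hd _ _ (hQ i).2 (hP i).2)
  set bd : Finset (ℤ × ℤ) := Finset.univ.biUnion s with hbd
  have hbdcard : bd.card ≤ 4 * (9 * (n + 1)) := by
    refine (Finset.card_biUnion_le_card_mul _ _ _ fun i _ => hs i).trans ?_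
    simp
  set I : Finset (ℤ × ℤ) := Finset.Icc (-⌈ρ⌉ - 1) (⌈ρ⌉) ×ˢ Finset.Icc (-⌈ρ⌉ - 1) (⌈ρ⌉) with hI
  have hIK : ∀ z ∈ K, planeFloor z ∈ I := by
    have key : ∀ a : ℝ, |a| ≤ ρ → ⌊a⌋ ∈ Finset.Icc (-⌈ρ⌉ - 1) (⌈ρ⌉) := by
      intro a ha
      rw [abs_le] at ha
      have h1 := Int.floor_le a
      have h2 := Int.lt_floor_add_one a
      have h3 := Int.le_ceil ρ
      rw [Finset.mem_Icc]
      constructor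
      · have : ((-⌈ρ⌉ - 1 : ℤ) : ℝ) < ((⌊a⌋ + 1 : ℤ) : ℝ) := by push_cast; linarith
        have := Int.cast_lt.1 this
        omega
      · have : ((⌊a⌋ : ℤ) : ℝ) ≤ ((⌈ρ⌉ : ℤ) : ℝ) := by linarith
        exact Int.cast_le.1 this
    intro z hz
    exact Finset.mem_product.2 ⟨key _ (hρ z hz).1, key _ (hρ z hz).2⟩
  have hset : {v : ℤ × ℤ | latticePoint v ∈ K} = ((I.filter fun v => latticePoint v ∈ K :
      Finset (ℤ × ℤ)) : Set (ℤ × ℤ)) := by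
    ext v
    simp only [mem_ofPred_eq, Finset.coe_filter]
    refine ⟨fun h => ⟨?_, h⟩, fun h => h.2⟩
    have := hIK _ h
    rwa [mem_unitCell_iff.1 (latticePoint_mem_unitCell v)] at this
  refine ⟨hset ▸ Finset.finite_toSet _, ?_⟩
  have hvol : volume.real K = ∑ v ∈ I, volume.real (K ∩ unitCell v) := by
    rw [← measureReal_biUnion_finset ?_ ?_ ?_]
    · congr 1
      ext z
      simp only [mem_iUnion, mem_inter_iff, exists_prop]
      refine ⟨fun h => ⟨_, hIK z h, h, mem_unitCell_iff.2 rfl⟩, fun ⟨_, _, h, _⟩ => h⟩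
    · intro v _ w _ hvw
      refine disjoint_left.2 fun z hz hz' => hvw ?_
      rw [← mem_unitCell_iff.1 hz.2, ← mem_unitCell_iff.1 hz'.2]
    · intro v _
      exact hK.measurableSet.inter (measurableSet_unitCell v)
    · intro v _
      exact ((measure_mono inter_subset_right).trans_lt (by rw [volume_unitCell]; simp)).ne
  have hcell : ∀ v, volume.real (unitCell v) = 1 := fun v => by
    rw [measureReal_def, volume_unitCell]; simp
  -- A cell contains its corner as its only lattice point and has area one, so count and area agree
  -- on cells away from the frontier and differ by at most one on the others.
  have hterm : ∀ v, |(if latticePoint v ∈ K then (1 : ℝ) else 0) - volume.real (K ∩ unitCell v)|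
      ≤ if v ∈ bd then 1 else 0 := by
    intro v
    by_cases hv : v ∈ bd
    · rw [if_pos hv]
      have h0 : 0 ≤ volume.real (K ∩ unitCell v) := measureReal_nonneg
      have h1 : volume.real (K ∩ unitCell v) ≤ 1 := by
        rw [← hcell v]
        exact measureReal_mono inter_subset_right (by rw [volume_unitCell]; simp)
      rw [abs_le]
      split_ifs <;> constructor <;> linarith
    · rw [if_neg hv]
      have hdis : Disjoint (unitCell v) (frontier K) := by
        refine disjoint_left.2 fun z hz hz' => hv ?_
        obtain ⟨i, hi⟩ := mem_iUnion.1 (hfr hz')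
        rw [← mem_unitCell_iff.1 hz]
        exact Finset.mem_biUnion.2 ⟨i, Finset.mem_univ _, hs' i z hi⟩
      rcases unitCell_subset_or_disjoint hK hdis with h | h
      · rw [if_pos (h (latticePoint_mem_unitCell v)), inter_eq_self_of_subset_right h, hcell]
        simp
      · rw [if_neg (disjoint_left.1 h (latticePoint_mem_unitCell v)), inter_comm,
          disjoint_iff_inter_eq_empty.1 h]
        simp
  have hfinal : (({v : ℤ × ℤ | latticePoint v ∈ K}.ncard : ℝ)) =
      ∑ v ∈ I, if latticePoint v ∈ K then (1 : ℝ) else 0 := by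
    rw [hset, ncard_coe_finset, Finset.card_filter]
    push_cast
    rfl
  rw [hfinal, hvol, ← Finset.sum_sub_distrib]
  refine (Finset.abs_sum_le_sum_abs _ _).trans ((Finset.sum_le_sum fun v _ => hterm v).trans ?_)
  rw [Finset.sum_ite_mem, Finset.sum_const, nsmul_eq_mul, mul_one]
  have h1 : ((I ∩ bd).card : ℝ) ≤ (4 * (9 * (n + 1)) : ℕ) := by
    exact_mod_cast (Finset.card_le_card Finset.inter_subset_right).trans hbdcard
  refine h1.trans ?_
  push_cast
  linarith

/-! ### Plane sectors -/

/-- The trapezoid of the points `α p + β q` with `r₀ ≤ α ≤ r₁` and `|β| ≤ κ α`, where `p`, `q` is a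
unimodular basis of the plane. -/
def sector (p q : ℝ × ℝ) (r₀ r₁ κ : ℝ) : Set (ℝ × ℝ) :=
  {z | r₀ ≤ z.1 * q.2 - z.2 * q.1 ∧ z.1 * q.2 - z.2 * q.1 ≤ r₁ ∧
    |p.1 * z.2 - p.2 * z.1| ≤ κ * (z.1 * q.2 - z.2 * q.1)}

lemma isClosed_sector (p q : ℝ × ℝ) (r₀ r₁ κ : ℝ) : IsClosed (sector p q r₀ r₁ κ) := by
  simp only [sector, ofPred_and]
  exact (isClosed_le (by fun_prop) (by fun_prop)).inter
    ((isClosed_le (by fun_prop) (by fun_prop)).inter (isClosed_le (by fun_prop) (by fun_prop)))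

lemma smul_mem_sector_iff {p q z : ℝ × ℝ} {r₀ r₁ κ s : ℝ} (hs : 0 < s) :
    s • z ∈ sector p q (s * r₀) (s * r₁) κ ↔ z ∈ sector p q r₀ r₁ κ := by
  have e1 : (s • z).1 * q.2 - (s • z).2 * q.1 = s * (z.1 * q.2 - z.2 * q.1) := by
    simp; ring
  have e2 : p.1 * (s • z).2 - p.2 * (s • z).1 = s * (p.1 * z.2 - p.2 * z.1) := by
    simp; ring
  simp only [sector, mem_ofPred_eq, e1, e2]
  rw [mul_le_mul_iff_right₀ hs, mul_le_mul_iff_right₀ hs, abs_mul, abs_of_pos hs, mul_left_comm κ s,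
    mul_le_mul_iff_right₀ hs]

lemma sector_smul (p q : ℝ × ℝ) (r₀ r₁ κ : ℝ) {s : ℝ} (hs : 0 < s) :
    sector p q (s * r₀) (s * r₁) κ = (fun z => s⁻¹ • z) ⁻¹' sector p q r₀ r₁ κ := by
  ext z
  rw [mem_preimage, ← smul_mem_sector_iff (z := s⁻¹ • z) hs, smul_inv_smul₀ hs.ne']

lemma volume_real_sector_smul (p q : ℝ × ℝ) (r₀ r₁ κ : ℝ) {s : ℝ} (hs : 0 < s) :
    volume.real (sector p q (s * r₀) (s * r₁) κ) = s ^ 2 * volume.real (sector p q r₀ r₁ κ) := by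
  rw [sector_smul _ _ _ _ _ hs, preimage_smul_inv₀ hs.ne', measureReal_def,
    Measure.addHaar_smul_of_nonneg _ hs.le]
  rw [ENNReal.toReal_mul, ENNReal.toReal_ofReal (by positivity), measureReal_def]
  simp

/-- The points satisfying all inequalities strictly form an open set, so at a frontier point one
inequality is an equality. Equality in `α` gives one of the two parallel edges (`across`), equality
in `|β| ≤ κ α` one of the two edges on rays from the origin (`along`). -/
lemma frontier_sector_subset {p q : ℝ × ℝ} (hpq : p.1 * q.2 - p.2 * q.1 = 1) {r₀ r₁ κ : ℝ}
    (hr : 0 < r₀) (hr' : r₀ < r₁) (hκ : 0 < κ) :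
    frontier (sector p q r₀ r₁ κ) ⊆ ⋃ i, segment ℝ
      ((![r₀ • (p - κ • q), r₁ • (p - κ • q), r₀ • (p - κ • q), r₀ • (p + κ • q)] :
        Fin 4 → ℝ × ℝ) i)
      ((![r₀ • (p + κ • q), r₁ • (p + κ • q), r₁ • (p - κ • q), r₁ • (p + κ • q)] :
        Fin 4 → ℝ × ℝ) i) := by
  intro z hz
  rw [(isClosed_sector _ _ _ _ _).frontier_eq] at hz
  obtain ⟨⟨h0, h1, h2⟩, hint⟩ := hz
  have hopen : IsOpen {z : ℝ × ℝ | r₀ < z.1 * q.2 - z.2 * q.1 ∧ z.1 * q.2 - z.2 * q.1 < r₁ ∧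
      |p.1 * z.2 - p.2 * z.1| < κ * (z.1 * q.2 - z.2 * q.1)} := by
    simp only [ofPred_and]
    exact (isOpen_lt (by fun_prop) (by fun_prop)).inter
      ((isOpen_lt (by fun_prop) (by fun_prop)).inter (isOpen_lt (by fun_prop) (by fun_prop)))
  have hnot : ¬ (r₀ < z.1 * q.2 - z.2 * q.1 ∧ z.1 * q.2 - z.2 * q.1 < r₁ ∧
      |p.1 * z.2 - p.2 * z.1| < κ * (z.1 * q.2 - z.2 * q.1)) := fun h =>
    hint (mem_interior.2 ⟨_, fun _ hw => ⟨hw.1.le, hw.2.1.le, hw.2.2.le⟩, hopen, h⟩)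
  have hz1 : z.1 = (z.1 * q.2 - z.2 * q.1) * p.1 + (p.1 * z.2 - p.2 * z.1) * q.1 := by
    linear_combination (-z.1) * hpq
  have hz2 : z.2 = (z.1 * q.2 - z.2 * q.1) * p.2 + (p.1 * z.2 - p.2 * z.1) * q.2 := by
    linear_combination (-z.2) * hpq
  set α := z.1 * q.2 - z.2 * q.1
  set β := p.1 * z.2 - p.2 * z.1
  rw [abs_le] at h2
  have across : ∀ r : ℝ, 0 < r → α = r → z ∈ segment ℝ (r • (p - κ • q)) (r • (p + κ • q)) := by
    intro r hr0 hα
    rw [hα] at hz1 hz2 h2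
    have hκr : 0 < 2 * (κ * r) := by positivity
    refine ⟨(κ * r - β) / (2 * (κ * r)), (κ * r + β) / (2 * (κ * r)),
      div_nonneg (by linarith) hκr.le, div_nonneg (by linarith) hκr.le, by field_simp; ring, ?_⟩
    ext
    · simp only [Prod.fst_add, Prod.smul_fst, Prod.fst_sub, smul_eq_mul]
      rw [hz1]; field_simp; ring
    · simp only [Prod.snd_add, Prod.smul_snd, Prod.snd_sub, smul_eq_mul]
      rw [hz2]; field_simp; ring
  have along : ∀ w : ℝ × ℝ, z = α • w → z ∈ segment ℝ (r₀ • w) (r₁ • w) := by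
    intro w hw
    have hd : 0 < r₁ - r₀ := by linarith
    refine ⟨(r₁ - α) / (r₁ - r₀), (α - r₀) / (r₁ - r₀), div_nonneg (by linarith) hd.le,
      div_nonneg (by linarith) hd.le, by field_simp; ring, ?_⟩
    rw [hw, smul_smul, smul_smul, ← add_smul]
    congr 1
    field_simp
    ring
  rw [mem_iUnion]
  by_cases c0 : r₀ = α
  · exact ⟨0, across r₀ hr c0.symm⟩
  by_cases c1 : α = r₁
  · exact ⟨1, across r₁ (hr.trans hr') c1⟩
  have c2 : ¬ |β| < κ * α := fun h => hnot ⟨lt_of_le_of_ne h0 c0, lt_of_le_of_ne h1 c1, h⟩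
  rcases le_or_gt 0 β with hβ | hβ
  · have hβ' : β = κ * α := by
      rw [abs_of_nonneg hβ] at c2
      linarith
    refine ⟨3, along (p + κ • q) ?_⟩
    ext
    · simp only [Prod.smul_fst, Prod.fst_add, smul_eq_mul]
      rw [hz1, hβ']; ring
    · simp only [Prod.smul_snd, Prod.snd_add, smul_eq_mul]
      rw [hz2, hβ']; ring
  · have hβ' : β = -(κ * α) := by
      rw [abs_of_neg hβ] at c2
      linarith
    refine ⟨2, along (p - κ • q) ?_⟩
    ext
    · simp only [Prod.smul_fst, Prod.fst_sub, smul_eq_mul]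
      rw [hz1, hβ']; ring
    · simp only [Prod.smul_snd, Prod.snd_sub, smul_eq_mul]
      rw [hz2, hβ']; ring

lemma smul_add_mem_sector {p q : ℝ × ℝ} (hpq : p.1 * q.2 - p.2 * q.1 = 1) {r₀ r₁ κ r σ : ℝ}
    (h0 : r₀ ≤ r) (h1 : r ≤ r₁) (hr : 0 < r) (hσ : |σ| ≤ κ) :
    r • (p + σ • q) ∈ sector p q r₀ r₁ κ := by
  have e1 : (r • (p + σ • q)).1 * q.2 - (r • (p + σ • q)).2 * q.1 = r := by
    simp; linear_combination r * hpq
  have e2 : p.1 * (r • (p + σ • q)).2 - p.2 * (r • (p + σ • q)).1 = r * σ := by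
    simp; linear_combination r * σ * hpq
  simp only [sector, mem_ofPred_eq, e1, e2]
  refine ⟨h0, h1, ?_⟩
  rw [abs_mul, abs_of_pos hr, mul_comm]
  exact mul_le_mul_of_nonneg_right hσ hr.le

/-- Lattice point count in a dilated trapezoid. -/
theorem abs_ncard_latticePoint_sector_sub_le {p q : ℝ × ℝ} (hpq : p.1 * q.2 - p.2 * q.1 = 1)
    {r₀ r₁ κ ρ s : ℝ} (hr : 0 < r₀) (hr' : r₀ < r₁) (hκ : 0 < κ) (hs : 0 < s)
    (hρ : ∀ z ∈ sector p q r₀ r₁ κ, |z.1| ≤ ρ ∧ |z.2| ≤ ρ) :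
    {v : ℤ × ℤ | latticePoint v ∈ sector p q (s * r₀) (s * r₁) κ}.Finite ∧
    |({v : ℤ × ℤ | latticePoint v ∈ sector p q (s * r₀) (s * r₁) κ}.ncard : ℝ) -
      s ^ 2 * volume.real (sector p q r₀ r₁ κ)| ≤ 144 * (s * ρ + 1) := by
  have hsρ : ∀ z ∈ sector p q (s * r₀) (s * r₁) κ, |z.1| ≤ s * ρ ∧ |z.2| ≤ s * ρ := by
    intro z hz
    rw [sector_smul _ _ _ _ _ hs] at hz
    have := hρ _ hz
    simp only [Prod.smul_fst, Prod.smul_snd, smul_eq_mul, abs_mul, abs_inv, abs_of_pos hs] at this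
    rwa [inv_mul_le_iff₀ hs, inv_mul_le_iff₀ hs] at this
  have hsr : 0 < s * r₀ := by positivity
  have hsr' : s * r₀ < s * r₁ := mul_lt_mul_of_pos_left hr' hs
  have hsr1 : 0 < s * r₁ := hsr.trans hsr'
  have m0 : ∀ r, s * r₀ ≤ r → r ≤ s * r₁ → r • (p + κ • q) ∈ sector p q (s * r₀) (s * r₁) κ :=
    fun r h h' => smul_add_mem_sector hpq h h' (hsr.trans_le h) (abs_of_pos hκ).le
  have m1 : ∀ r, s * r₀ ≤ r → r ≤ s * r₁ → r • (p - κ • q) ∈ sector p q (s * r₀) (s * r₁) κ := by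
    intro r h h'
    have := smul_add_mem_sector hpq h h' (hsr.trans_le h) (σ := -κ)
      (by rw [abs_neg, abs_of_pos hκ])
    rwa [neg_smul, ← sub_eq_add_neg] at this
  have hρ0 : 0 ≤ s * ρ :=
    (abs_nonneg _).trans (hsρ _ (m0 _ le_rfl hsr'.le)).1
  rw [← volume_real_sector_smul _ _ _ _ _ hs]
  refine abs_ncard_latticePoint_sub_area_le (isClosed_sector _ _ _ _ _) hsρ hρ0 _ _ ?_ ?_
    (frontier_sector_subset hpq hsr hsr' hκ)
  · intro i
    fin_cases i
    · exact hsρ _ (m1 _ le_rfl hsr'.le)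
    · exact hsρ _ (m1 _ hsr'.le le_rfl)
    · exact hsρ _ (m1 _ le_rfl hsr'.le)
    · exact hsρ _ (m0 _ le_rfl hsr'.le)
  · intro i
    fin_cases i
    · exact hsρ _ (m0 _ le_rfl hsr'.le)
    · exact hsρ _ (m0 _ hsr'.le le_rfl)
    · exact hsρ _ (m1 _ hsr'.le le_rfl)
    · exact hsρ _ (m0 _ hsr'.le le_rfl)

/-! ### Möbius inversion and primitive lattice points -/

open scoped ArithmeticFunction.Moebius LSeries.notation in
-- The Dirichlet series of `μ` is the inverse of `ζ`, and `ζ(2) = π²/6`.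
lemma hasSum_moebius_div_sq :
    HasSum (fun n : ℕ => (ArithmeticFunction.moebius n : ℝ) / (n : ℝ) ^ 2) (6 / Real.pi ^ 2) := by
  have h2 : (1 : ℝ) < (2 : ℂ).re := by norm_num
  have hs : LSeriesSummable (fun n => ((ArithmeticFunction.moebius n : ℤ) : ℂ)) 2 :=
    ArithmeticFunction.LSeriesSummable_moebius_iff.2 h2
  have h1 := LSeries_one_mul_Lseries_moebius h2
  rw [LSeries_one_eq_riemannZeta h2, riemannZeta_two] at h1
  have hL : LSeries (fun n => ((ArithmeticFunction.moebius n : ℤ) : ℂ)) 2 =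
      ((6 / Real.pi ^ 2 : ℝ) : ℂ) := by
    have hpi : (Real.pi : ℂ) ≠ 0 := by exact_mod_cast Real.pi_ne_zero
    push_cast
    field_simp at h1 ⊢
    linear_combination h1
  have hsum : HasSum _ _ := hs.hasSum
  rw [← LSeries, hL] at hsum
  rw [← Complex.hasSum_ofReal]
  convert hsum using 2 with n
  rcases eq_or_ne n 0 with rfl | hn
  · simp
  · rw [LSeries.term_of_ne_zero hn]
    push_cast
    norm_cast

lemma abs_sum_moebius_div_sq_sub_le {D : ℕ} (hD : D ≠ 0) :
    |∑ d ∈ Finset.Icc 1 D, (ArithmeticFunction.moebius d : ℝ) / (d : ℝ) ^ 2 - 6 / Real.pi ^ 2| ≤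
      (1 / D : ℝ) := by
  have hrange : ∀ N : ℕ, ∑ d ∈ Finset.Icc 1 N, (ArithmeticFunction.moebius d : ℝ) / (d : ℝ) ^ 2 =
      ∑ d ∈ Finset.range (N + 1), (ArithmeticFunction.moebius d : ℝ) / (d : ℝ) ^ 2 := by
    intro N
    have h : Finset.Icc 1 N = Finset.Ico 1 (N + 1) := by
      ext i; simp only [Finset.mem_Icc, Finset.mem_Ico]; omega
    rw [h, Finset.range_eq_Ico, Finset.sum_eq_sum_Ico_succ_bot (Nat.succ_pos N)]
    simp
  have ht := (hasSum_moebius_div_sq.tendsto_sum_nat.comp (Filter.tendsto_add_atTop_nat 1))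
  have ht' := (ht.const_sub
    (∑ d ∈ Finset.Icc 1 D, (ArithmeticFunction.moebius d : ℝ) / (d : ℝ) ^ 2)).abs
  refine le_of_tendsto ht' (Filter.eventually_atTop.2 ⟨D, fun N hN => ?_⟩)
  rw [Function.comp_apply, ← hrange, abs_sub_comm]
  have hsplit : Finset.Icc 1 N = Finset.Icc 1 D ∪ Finset.Ioc D N := by
    ext i; simp only [Finset.mem_union, Finset.mem_Icc, Finset.mem_Ioc]; omega
  have hdis : Disjoint (Finset.Icc 1 D) (Finset.Ioc D N) := by
    rw [Finset.disjoint_left]; intro i; simp only [Finset.mem_Icc, Finset.mem_Ioc]; omega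
  rw [hsplit, Finset.sum_union hdis, add_sub_cancel_left]
  refine (Finset.abs_sum_le_sum_abs _ _).trans ?_
  have hle : ∀ d ∈ Finset.Ioc D N,
      |(ArithmeticFunction.moebius d : ℝ) / (d : ℝ) ^ 2| ≤ ((d : ℝ) ^ 2)⁻¹ := by
    intro d _
    have h1 : |(ArithmeticFunction.moebius d : ℝ)| ≤ 1 := by
      exact_mod_cast ArithmeticFunction.abs_moebius_le_one
    rw [abs_div, abs_of_nonneg (by positivity : (0 : ℝ) ≤ (d : ℝ) ^ 2), div_eq_mul_inv]
    exact mul_le_of_le_one_left (by positivity) h1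
  refine (Finset.sum_le_sum hle).trans ((sum_Ioc_inv_sq_le_sub hD hN).trans ?_)
  rw [one_div]
  have : (0 : ℝ) ≤ (N : ℝ)⁻¹ := by positivity
  linarith

/-- The range of `d` is fixed instead of being the divisors of `n`, so that the sums over `d` and
over lattice points can be interchanged. -/
lemma sum_Icc_moebius_eq {n D : ℕ} (hn : n ≠ 0) (hD : n ≤ D) :
    (∑ d ∈ Finset.Icc 1 D, if d ∣ n then (ArithmeticFunction.moebius d : ℝ) else 0) =
      if n = 1 then 1 else 0 := by
  have h := congrArg (fun f => f n) ArithmeticFunction.moebius_mul_coe_zeta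
  simp only [ArithmeticFunction.coe_mul_zeta_apply, ArithmeticFunction.one_apply] at h
  rw [← Finset.sum_filter]
  have hf : (Finset.Icc 1 D).filter (fun d => d ∣ n) = n.divisors := by
    ext d
    simp only [Finset.mem_filter, Finset.mem_Icc, Nat.mem_divisors]
    constructor
    · rintro ⟨_, h⟩; exact ⟨h, hn⟩
    · rintro ⟨h, _⟩
      exact ⟨⟨Nat.pos_of_dvd_of_pos h (by omega), (Nat.le_of_dvd (by omega) h).trans hD⟩, h⟩
  rw [hf]
  exact_mod_cast h

lemma latticePoint_mul (d : ℕ) (w : ℤ × ℤ) :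
    latticePoint ((d : ℤ) * w.1, (d : ℤ) * w.2) = (d : ℝ) • latticePoint w := by
  simp [latticePoint]

/-- Möbius inversion for the number of primitive lattice points in a trapezoid. -/
lemma ncard_primitive_eq_sum_moebius {p q : ℝ × ℝ} {r₀ r₁ κ T : ℝ} (hr : 0 < r₀) (hT : 0 < T)
    {D : ℕ} (hfin : {v : ℤ × ℤ | latticePoint v ∈ sector p q (T * r₀) (T * r₁) κ}.Finite)
    (hD : ∀ v : ℤ × ℤ, latticePoint v ∈ sector p q (T * r₀) (T * r₁) κ →
      |(v.1 : ℝ)| < D + 1 ∧ |(v.2 : ℝ)| < D + 1) :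
    ({v : ℤ × ℤ | IsCoprime v.1 v.2 ∧
      latticePoint v ∈ sector p q (T * r₀) (T * r₁) κ}.ncard : ℝ) =
    ∑ d ∈ Finset.Icc 1 D, (ArithmeticFunction.moebius d : ℝ) *
      {v : ℤ × ℤ | latticePoint v ∈ sector p q (T / d * r₀) (T / d * r₁) κ}.ncard := by
  classical
  set S := hfin.toFinset with hS
  have hmem : ∀ v, v ∈ S ↔ latticePoint v ∈ sector p q (T * r₀) (T * r₁) κ := fun v => by
    simp [hS]
  -- The origin is excluded because `r₀ > 0`, and the gcd divides a nonzero coordinate, which is at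
  -- most `D` in absolute value.
  have hgcd : ∀ v ∈ S, Int.gcd v.1 v.2 ≠ 0 ∧ Int.gcd v.1 v.2 ≤ D := by
    intro v hv
    rw [hmem] at hv
    have hne : Int.gcd v.1 v.2 ≠ 0 := by
      intro h
      rw [Int.gcd_eq_zero_iff] at h
      have h0 := hv.1
      simp only [latticePoint, h.1, h.2, Int.cast_zero, zero_mul, sub_zero] at h0
      have : 0 < T * r₀ := by positivity
      linarith
    refine ⟨hne, ?_⟩
    obtain ⟨h1, h2⟩ := hD v hv
    have conv : ∀ k : ℤ, |(k : ℝ)| < D + 1 → k.natAbs ≤ D := by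
      intro k hk
      have : ((k.natAbs : ℤ) : ℝ) < ((D + 1 : ℤ) : ℝ) := by
        rw [Int.natCast_natAbs]; push_cast; exact hk
      have := Int.cast_lt.1 this
      omega
    by_cases h : v.1 = 0
    · have h' : v.2 ≠ 0 := fun h' => hne (Int.gcd_eq_zero_iff.2 ⟨h, h'⟩)
      exact (Nat.le_of_dvd (Int.natAbs_pos.2 h') (Int.natAbs_dvd_natAbs.2
        (Int.gcd_dvd_right v.1 v.2))).trans (conv _ h2)
    · exact (Nat.le_of_dvd (Int.natAbs_pos.2 h) (Int.natAbs_dvd_natAbs.2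
        (Int.gcd_dvd_left v.1 v.2))).trans (conv _ h1)
  have hleft : {v : ℤ × ℤ | IsCoprime v.1 v.2 ∧
      latticePoint v ∈ sector p q (T * r₀) (T * r₁) κ} =
      ((S.filter fun v => Int.gcd v.1 v.2 = 1 : Finset (ℤ × ℤ)) : Set (ℤ × ℤ)) := by
    ext v
    simp only [mem_ofPred_eq, Finset.coe_filter, hmem, Int.isCoprime_iff_gcd_eq_one, and_comm]
  -- Multiplication by `d` maps the lattice points of the `T / d` dilate bijectively to those of the
  -- `T` dilate whose gcd is divisible by `d`.
  have hright : ∀ d ∈ Finset.Icc 1 D,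
      {v : ℤ × ℤ | latticePoint v ∈ sector p q (T / d * r₀) (T / d * r₁) κ}.ncard =
        (S.filter fun v => d ∣ Int.gcd v.1 v.2).card := by
    intro d hd
    have hd0 : 0 < d := (Finset.mem_Icc.1 hd).1
    have hdR : (0 : ℝ) < d := by exact_mod_cast hd0
    have hdZ : (d : ℤ) ≠ 0 := by exact_mod_cast hd0.ne'
    rw [← ncard_coe_finset, ← ncard_image_of_injective _
      (f := fun w : ℤ × ℤ => ((d : ℤ) * w.1, (d : ℤ) * w.2))]
    · congr 1
      ext v
      simp only [mem_image, mem_ofPred_eq, Finset.coe_filter, hmem]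
      have hiff : ∀ w : ℤ × ℤ, latticePoint w ∈ sector p q (T / d * r₀) (T / d * r₁) κ ↔
          latticePoint ((d : ℤ) * w.1, (d : ℤ) * w.2) ∈ sector p q (T * r₀) (T * r₁) κ := by
        intro w
        rw [latticePoint_mul, ← smul_mem_sector_iff hdR, ← mul_assoc, ← mul_assoc,
          mul_div_cancel₀ _ hdR.ne']
      constructor
      · rintro ⟨w, hw, rfl⟩
        refine ⟨(hiff w).1 hw, ?_⟩
        exact Int.dvd_coe_gcd_iff.2 ⟨dvd_mul_right _ _, dvd_mul_right _ _⟩ |> Int.natCast_dvd_natCast.1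
      · rintro ⟨hv, hdv⟩
        obtain ⟨⟨a, ha⟩, ⟨b, hb⟩⟩ := Int.dvd_coe_gcd_iff.1 (Int.natCast_dvd_natCast.2 hdv)
        have hab : v = ((d : ℤ) * a, (d : ℤ) * b) := Prod.ext ha hb
        refine ⟨(a, b), (hiff (a, b)).2 ?_, hab.symm⟩
        rwa [← hab]
    · intro v w hvw
      simp only [Prod.mk.injEq, mul_eq_mul_left_iff, hdZ, or_false] at hvw
      exact Prod.ext hvw.1 hvw.2
  rw [hleft, ncard_coe_finset, Finset.card_filter]
  push_cast
  rw [Finset.sum_congr rfl fun v hv => (sum_Icc_moebius_eq (hgcd v hv).1 (hgcd v hv).2).symm,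
    Finset.sum_comm]
  refine Finset.sum_congr rfl fun d hd => ?_
  rw [hright d hd, ← Finset.sum_filter, Finset.sum_const, nsmul_eq_mul, mul_comm]

/-- Primitive lattice points in dilated trapezoids, with an error term which is uniform over all
trapezoids contained in a fixed square. -/
theorem exists_abs_ncard_primitive_sub_le (ρ : ℝ) :
    ∃ c : ℝ, 0 < c ∧ ∀ (p q : ℝ × ℝ), p.1 * q.2 - p.2 * q.1 = 1 → ∀ r₀ r₁ κ : ℝ, 0 < r₀ → r₀ < r₁ →
      0 < κ → (∀ z ∈ sector p q r₀ r₁ κ, |z.1| ≤ ρ ∧ |z.2| ≤ ρ) → ∀ T : ℝ, 0 < T → 2 ≤ T ^ 2 →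
      |({v : ℤ × ℤ | IsCoprime v.1 v.2 ∧
        latticePoint v ∈ sector p q (T * r₀) (T * r₁) κ}.ncard : ℝ) -
        T ^ 2 * (volume.real (sector p q r₀ r₁ κ) * (6 / Real.pi ^ 2))| ≤ c * (T * Real.log T) := by
  wlog hρ : 1 ≤ ρ generalizing ρ
  · obtain ⟨c, hc, h⟩ := this 1 le_rfl
    refine ⟨c, hc, fun p q hpq r₀ r₁ κ h0 h1 h2 hb => h p q hpq r₀ r₁ κ h0 h1 h2 fun z hz => ?_⟩
    have := hb z hz
    constructor <;> linarith
  have hlogρ : 0 ≤ Real.log ρ := Real.log_nonneg hρ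
  -- The two error terms add up to `Tρ (296 + 144 log ρ) + 144 Tρ log T`. The factor 3 absorbs the
  -- first summand, since `T² ≥ 2` forces `3 log T ≥ 1`.
  refine ⟨ρ * (144 + 3 * (296 + 144 * Real.log ρ)), by positivity, ?_⟩
  intro p q hpq r₀ r₁ κ hr hr' hκ hb T hT hT2
  have hT1 : 1 ≤ T := by nlinarith
  have hlogT : 1 / 3 ≤ Real.log T := by
    have h1 := Real.log_le_log (by norm_num) hT2
    rw [Real.log_pow] at h1
    have := Real.log_two_gt_d9
    push_cast at h1
    linarith
  have hTρ : 1 ≤ T * ρ := one_le_mul_of_one_le_of_one_le hT1 hρ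
  -- Coordinates in the dilated trapezoid are at most `Tρ`, so no larger `d` can occur.
  set D := ⌊T * ρ⌋₊ with hDdef
  have hD1 : (D : ℝ) ≤ T * ρ := Nat.floor_le (by positivity)
  have hD2 : T * ρ < D + 1 := Nat.lt_floor_add_one _
  have hD0 : 1 ≤ D := Nat.le_floor (by simpa using hTρ)
  have hD0' : (1 : ℝ) ≤ D := by exact_mod_cast hD0
  set A := volume.real (sector p q r₀ r₁ κ) with hA
  have hA0 : 0 ≤ A := measureReal_nonneg
  have hA1 : A ≤ 4 * ρ ^ 2 := by
    have hsub : sector p q r₀ r₁ κ ⊆ Icc (-ρ) ρ ×ˢ Icc (-ρ) ρ := fun z hz =>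
      ⟨abs_le.1 (hb z hz).1, abs_le.1 (hb z hz).2⟩
    have hv : volume.real (Icc (-ρ) ρ ×ˢ Icc (-ρ) ρ) = 4 * ρ ^ 2 := by
      rw [Measure.volume_eq_prod, measureReal_prod_prod, Real.volume_real_Icc_of_le (by linarith)]
      ring
    rw [← hv]
    refine measureReal_mono hsub ?_
    rw [Measure.volume_eq_prod, Measure.prod_prod]
    simp [ENNReal.mul_eq_top]
  have hTb : ∀ z ∈ sector p q (T * r₀) (T * r₁) κ, |z.1| ≤ T * ρ ∧ |z.2| ≤ T * ρ := by
    intro z hz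
    rw [sector_smul _ _ _ _ _ hT] at hz
    have := hb _ hz
    simp only [Prod.smul_fst, Prod.smul_snd, smul_eq_mul, abs_mul, abs_inv, abs_of_pos hT] at this
    rwa [inv_mul_le_iff₀ hT, inv_mul_le_iff₀ hT] at this
  have hcount : ∀ s : ℝ, 0 < s → _ ∧ _ := fun s hs =>
    abs_ncard_latticePoint_sector_sub_le hpq hr hr' hκ hs hb
  rw [ncard_primitive_eq_sum_moebius hr hT (hcount T hT).1
    (fun v hv => ⟨(hTb _ hv).1.trans_lt hD2, (hTb _ hv).2.trans_lt hD2⟩)]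
  set L : ℕ → ℝ := fun d => {v : ℤ × ℤ | latticePoint v ∈ sector p q (T / d * r₀) (T / d * r₁) κ}.ncard
    with hL
  set m : ℕ → ℝ := fun d => (ArithmeticFunction.moebius d : ℝ) with hm
  have hm1 : ∀ d, |m d| ≤ 1 := fun d => by
    simp only [hm]
    exact_mod_cast ArithmeticFunction.abs_moebius_le_one
  -- The first sum collects the boundary errors `O(Tρ/d + 1)` and produces the harmonic sum, hence
  -- the logarithm; the second term is the tail of the Möbius series, of size `O(1/D)` against `T² A
  -- = O(T² ρ²)`.
  have hdecomp : ∑ d ∈ Finset.Icc 1 D, m d * L d - T ^ 2 * (A * (6 / Real.pi ^ 2)) =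
      ∑ d ∈ Finset.Icc 1 D, m d * (L d - (T / d) ^ 2 * A) +
      T ^ 2 * A * (∑ d ∈ Finset.Icc 1 D, m d / (d : ℝ) ^ 2 - 6 / Real.pi ^ 2) := by
    rw [mul_sub, Finset.mul_sum, ← add_sub_assoc, ← Finset.sum_add_distrib]
    congr 1
    · refine Finset.sum_congr rfl fun d _ => ?_
      ring
    · ring
  have herr1 : |∑ d ∈ Finset.Icc 1 D, m d * (L d - (T / d) ^ 2 * A)| ≤
      144 * (T * ρ * (2 + Real.log (T * ρ))) := by
    have hterm : ∀ d ∈ Finset.Icc 1 D, |m d * (L d - (T / d) ^ 2 * A)| ≤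
        144 * (T * ρ * (d : ℝ)⁻¹ + 1) := by
      intro d hd
      have hd0 : (0 : ℝ) < d := by exact_mod_cast (Finset.mem_Icc.1 hd).1
      rw [abs_mul]
      refine (mul_le_of_le_one_left (abs_nonneg _) (hm1 d)).trans ?_
      refine ((hcount (T / d) (by positivity)).2).trans_eq ?_
      ring
    refine (Finset.abs_sum_le_sum_abs _ _).trans ((Finset.sum_le_sum hterm).trans ?_)
    rw [← Finset.mul_sum, Finset.sum_add_distrib, ← Finset.mul_sum, Finset.sum_const,
      Nat.card_Icc, nsmul_eq_mul, mul_one, Nat.add_sub_cancel]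
    have hharm : ∑ d ∈ Finset.Icc 1 D, (d : ℝ)⁻¹ ≤ 1 + Real.log (T * ρ) := by
      have h1 := harmonic_le_one_add_log D
      rw [harmonic_eq_sum_Icc] at h1
      push_cast at h1
      exact h1.trans (by linarith [Real.log_le_log (by linarith) hD1])
    have := mul_le_mul_of_nonneg_left hharm (by linarith : 0 ≤ T * ρ)
    nlinarith
  have herr2 : |T ^ 2 * A * (∑ d ∈ Finset.Icc 1 D, m d / (d : ℝ) ^ 2 - 6 / Real.pi ^ 2)| ≤
      8 * (T * ρ) := by
    rw [abs_mul, abs_of_nonneg (by positivity)]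
    have h1 : |∑ d ∈ Finset.Icc 1 D, m d / (d : ℝ) ^ 2 - 6 / Real.pi ^ 2| ≤ 2 / (T * ρ) := by
      refine (abs_sum_moebius_div_sq_sub_le (by omega)).trans ?_
      rw [div_le_div_iff₀ (by linarith) (by linarith)]
      linarith
    calc _ ≤ T ^ 2 * (4 * ρ ^ 2) * (2 / (T * ρ)) :=
          mul_le_mul (mul_le_mul_of_nonneg_left hA1 (by positivity)) h1 (abs_nonneg _)
            (by positivity)
      _ = 8 * (T * ρ) := by
          have : ρ ≠ 0 := by linarith
          field_simp
          ring
  rw [hdecomp]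
  refine (abs_add_le _ _).trans ((add_le_add herr1 herr2).trans ?_)
  rw [Real.log_mul (by linarith) (by linarith)]
  have hlow : T * ρ * (296 + 144 * Real.log ρ) ≤
      T * ρ * (296 + 144 * Real.log ρ) * (3 * Real.log T) :=
    le_mul_of_one_le_right (by positivity) (by linarith)
  nlinarith

/-! ### Linear maps of the plane -/

/-- The linear map of the plane with matrix entries `a, b, c, d`. -/
def planeMap (a b c d : ℝ) (z : ℝ × ℝ) : ℝ × ℝ := (a * z.1 + b * z.2, c * z.1 + d * z.2)

lemma continuous_planeMap (a b c d : ℝ) : Continuous (planeMap a b c d) := by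
  unfold planeMap; fun_prop

lemma volume_preimage_planeMap {a b c d : ℝ} (h : a * d - b * c ≠ 0) (S : Set (ℝ × ℝ)) :
    volume (planeMap a b c d ⁻¹' S) = ENNReal.ofReal |(a * d - b * c)⁻¹| * volume S := by
  have e : planeMap a b c d = Matrix.toLin (Module.Basis.finTwoProd ℝ) (Module.Basis.finTwoProd ℝ)
      !![a, b; c, d] := by
    ext z <;> simp [planeMap]
  have hdet : LinearMap.det (Matrix.toLin (Module.Basis.finTwoProd ℝ) (Module.Basis.finTwoProd ℝ)
      !![a, b; c, d]) = a * d - b * c := by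
    rw [LinearMap.det_toLin, Matrix.det_fin_two_of]
  rw [e, Measure.addHaar_preimage_linearMap _ (by rw [hdet]; exact h), hdet]

lemma measurePreserving_planeMap {a b c d : ℝ} (h : a * d - b * c = 1) :
    MeasurePreserving (planeMap a b c d) := by
  refine ⟨(continuous_planeMap a b c d).measurable, Measure.ext fun S hS => ?_⟩
  rw [Measure.map_apply (continuous_planeMap a b c d).measurable hS,
    volume_preimage_planeMap (by rw [h]; exact one_ne_zero), h]
  simp

/-! ### The cone measure -/

/-- The determinant of the matrix with the two given columns. -/
def colDet (w : (ℝ × ℝ) × (ℝ × ℝ)) : ℝ := w.1.1 * w.2.2 - w.1.2 * w.2.1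

lemma continuous_colDet : Continuous colDet := by unfold colDet; fun_prop

lemma sl_det (g : SL(2, ℝ)) : g 0 0 * g 1 1 - g 0 1 * g 1 0 = 1 := by
  have := g.det_coe
  rwa [Matrix.det_fin_two] at this

/-- The matrix with the two given columns, rescaled to have determinant `1`. -/
def normalizeSL (w : (ℝ × ℝ) × (ℝ × ℝ)) : SL(2, ℝ) :=
  if h : 0 < colDet w then
    ⟨!![w.1.1 / √(colDet w), w.2.1 / √(colDet w); w.1.2 / √(colDet w), w.2.2 / √(colDet w)], by
      rw [Matrix.det_fin_two_of, div_mul_div_comm, div_mul_div_comm, Real.mul_self_sqrt h.le,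
        ← sub_div, mul_comm w.2.1]
      exact div_self h.ne'⟩
  else 1

lemma normalizeSL_apply {w : (ℝ × ℝ) × (ℝ × ℝ)} (h : 0 < colDet w) :
    normalizeSL w 0 0 = w.1.1 / √(colDet w) ∧ normalizeSL w 0 1 = w.2.1 / √(colDet w) ∧
    normalizeSL w 1 0 = w.1.2 / √(colDet w) ∧ normalizeSL w 1 1 = w.2.2 / √(colDet w) := by
  simp [normalizeSL, h]

lemma measurable_normalizeSL : Measurable normalizeSL := by
  classical
  have hopen : IsOpen {w | 0 < colDet w} := isOpen_lt continuous_const continuous_colDet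
  have e : normalizeSL = {w | 0 < colDet w}.piecewise normalizeSL (fun _ => 1) := by
    ext1 w
    by_cases h : 0 < colDet w
    · rw [piecewise_eq_of_mem _ _ _ (show w ∈ {w | 0 < colDet w} from h)]
    · rw [piecewise_eq_of_notMem _ _ _ (show w ∉ {w | 0 < colDet w} from h)]
      exact dif_neg h
  rw [e]
  refine ContinuousOn.measurable_piecewise ?_ continuousOn_const hopen.measurableSet
  rw [continuousOn_iff_continuous_domRestrict]
  refine Topology.IsInducing.subtypeVal.continuous_iff.2 ?_
  have hδ : Continuous fun w : {w | 0 < colDet w} => √(colDet w.1) :=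
    (continuous_colDet.comp continuous_subtype_val).sqrt
  have hne : ∀ w : {w | 0 < colDet w}, √(colDet w.1) ≠ 0 := fun w => (Real.sqrt_pos.2 w.2).ne'
  refine continuous_matrix fun i j => ?_
  have key : ∀ f : (ℝ × ℝ) × (ℝ × ℝ) → ℝ, Continuous f →
      Continuous fun w : {w | 0 < colDet w} => f w.1 / √(colDet w.1) := fun f hf =>
    (hf.comp continuous_subtype_val).div hδ hne
  fin_cases i <;> fin_cases j
  · exact (key (fun w => w.1.1) (by fun_prop)).congr fun w => (normalizeSL_apply w.2).1.symm
  · exact (key (fun w => w.2.1) (by fun_prop)).congr fun w => (normalizeSL_apply w.2).2.1.symm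
  · exact (key (fun w => w.1.2) (by fun_prop)).congr fun w => (normalizeSL_apply w.2).2.2.1.symm
  · exact (key (fun w => w.2.2) (by fun_prop)).congr fun w => (normalizeSL_apply w.2).2.2.2.symm

/-- The matrices of determinant in `(0, 1]`. -/
def detCone : Set ((ℝ × ℝ) × (ℝ × ℝ)) := {w | colDet w ∈ Ioc 0 1}

lemma measurableSet_detCone : MeasurableSet detCone :=
  continuous_colDet.measurable measurableSet_Ioc

/-- The measure on `SL(2, ℝ)` that gives a set the Lebesgue volume of the cone over it. -/
def coneMeasure : Measure SL(2, ℝ) := (volume.restrict detCone).map normalizeSL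

lemma coneMeasure_apply {S : Set SL(2, ℝ)} (hS : MeasurableSet S) :
    coneMeasure S = volume (normalizeSL ⁻¹' S ∩ detCone) := by
  rw [coneMeasure, Measure.map_apply measurable_normalizeSL hS,
    Measure.restrict_apply (measurable_normalizeSL hS)]

instance : SecondCountableTopology SL(2, ℝ) :=
  haveI : SecondCountableTopology (Matrix (Fin 2) (Fin 2) ℝ) :=
    inferInstanceAs (SecondCountableTopology (Fin 2 → Fin 2 → ℝ))
  Topology.IsInducing.subtypeVal.secondCountableTopology

/-- Left multiplication acts on each column by a linear map of determinant one. It preserves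
Lebesgue measure and `colDet`, hence `detCone`, and commutes with the rescaling. -/
instance : Measure.IsMulLeftInvariant coneMeasure := by
  refine ⟨fun g => ?_⟩
  have hg := sl_det g
  set G : (ℝ × ℝ) × (ℝ × ℝ) → (ℝ × ℝ) × (ℝ × ℝ) :=
    Prod.map (planeMap (g 0 0) (g 0 1) (g 1 0) (g 1 1))
      (planeMap (g 0 0) (g 0 1) (g 1 0) (g 1 1)) with hG
  have hGm : MeasurePreserving G :=
    (measurePreserving_planeMap hg).prod (measurePreserving_planeMap hg)
  have hdet : ∀ w, colDet (G w) = colDet w := by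
    intro w
    simp only [colDet, hG, Prod.map, planeMap]
    linear_combination (w.1.1 * w.2.2 - w.1.2 * w.2.1) * hg
  have hpre : G ⁻¹' detCone = detCone := by
    ext w
    simp only [detCone, mem_preimage, mem_ofPred_eq, hdet]
  have hcomp : ∀ w ∈ detCone, g * normalizeSL w = normalizeSL (G w) := by
    intro w hw
    have h0 : 0 < colDet w := hw.1
    have h0' : 0 < colDet (G w) := by rwa [hdet]
    obtain ⟨a1, a2, a3, a4⟩ := normalizeSL_apply h0
    obtain ⟨b1, b2, b3, b4⟩ := normalizeSL_apply h0'
    rw [hdet] at b1 b2 b3 b4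
    ext i j
    rw [Matrix.SpecialLinearGroup.coe_mul, Matrix.mul_apply, Fin.sum_univ_two]
    fin_cases i <;> fin_cases j
    · change g 0 0 * normalizeSL w 0 0 + g 0 1 * normalizeSL w 1 0 = normalizeSL (G w) 0 0
      rw [a1, a3, b1]; simp only [hG, Prod.map, planeMap]; ring
    · change g 0 0 * normalizeSL w 0 1 + g 0 1 * normalizeSL w 1 1 = normalizeSL (G w) 0 1
      rw [a2, a4, b2]; simp only [hG, Prod.map, planeMap]; ring
    · change g 1 0 * normalizeSL w 0 0 + g 1 1 * normalizeSL w 1 0 = normalizeSL (G w) 1 0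
      rw [a1, a3, b3]; simp only [hG, Prod.map, planeMap]; ring
    · change g 1 0 * normalizeSL w 0 1 + g 1 1 * normalizeSL w 1 1 = normalizeSL (G w) 1 1
      rw [a2, a4, b4]; simp only [hG, Prod.map, planeMap]; ring
  have hGr : MeasurePreserving G (volume.restrict detCone) (volume.restrict detCone) := by
    have := hGm.restrict_preimage measurableSet_detCone
    rwa [hpre] at this
  conv_rhs => rw [coneMeasure, ← hGr.map_eq, Measure.map_map measurable_normalizeSL hGr.measurable]
  rw [coneMeasure, Measure.map_map (measurable_const_mul g) measurable_normalizeSL]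
  refine Measure.map_congr ?_
  filter_upwards [ae_restrict_mem measurableSet_detCone] with w hw
  exact hcomp w hw

lemma continuous_slEntry (i j : Fin 2) : Continuous fun g : SL(2, ℝ) => g i j := by
  fun_prop

/-- The scaling factor `√δ` is at most one, so the cone over a compact set is bounded. With left
invariance, this permits comparison with Haar measure by uniqueness. -/
instance : IsFiniteMeasureOnCompacts coneMeasure := by
  refine ⟨fun K hK => ?_⟩
  have hb : ∀ i j, ∃ R, ∀ g ∈ K, |g i j| ≤ R := fun i j => by
    obtain ⟨R, hR⟩ := hK.exists_bound_of_continuousOn (continuous_slEntry i j).continuousOn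
    exact ⟨R, hR⟩
  choose R hR using hb
  rw [coneMeasure_apply hK.measurableSet]
  have hle : ∀ {x δ r : ℝ}, 0 < δ → δ ≤ 1 → |x / √δ| ≤ r → x ∈ Icc (-r) r := by
    intro x δ r h0 h1 hx
    have hs : 0 < √δ := Real.sqrt_pos.2 h0
    have hs1 : √δ ≤ 1 := Real.sqrt_le_one.2 h1
    rw [abs_div, abs_of_pos hs] at hx
    refine abs_le.1 (le_trans ?_ hx)
    rw [le_div_iff₀ hs]
    exact mul_le_of_le_one_right (abs_nonneg _) hs1
  refine (measure_mono (t := (Icc (-R 0 0) (R 0 0) ×ˢ Icc (-R 1 0) (R 1 0)) ×ˢ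
    (Icc (-R 0 1) (R 0 1) ×ˢ Icc (-R 1 1) (R 1 1))) ?_).trans_lt
    (((isCompact_Icc.prod isCompact_Icc).prod
      (isCompact_Icc.prod isCompact_Icc)).measure_lt_top)
  rintro w ⟨hwK, hw⟩
  obtain ⟨a1, a2, a3, a4⟩ := normalizeSL_apply hw.1
  refine ⟨⟨hle hw.1 hw.2 ?_, hle hw.1 hw.2 ?_⟩, hle hw.1 hw.2 ?_, hle hw.1 hw.2 ?_⟩
  · rw [← a1]; exact hR 0 0 _ hwK
  · rw [← a3]; exact hR 1 0 _ hwK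
  · rw [← a2]; exact hR 0 1 _ hwK
  · rw [← a4]; exact hR 1 1 _ hwK

/-- Ratios of Haar measures can be computed with the cone measure. -/
lemma haar_div_eq_coneMeasure_div (A F : Set SL(2, ℝ)) (hF : coneMeasure F ≠ 0) :
    (Measure.haar F)⁻¹ * Measure.haar A = (coneMeasure F)⁻¹ * coneMeasure A := by
  have h := Measure.isMulLeftInvariant_eq_smul coneMeasure (Measure.haar : Measure SL(2, ℝ))
  set c := Measure.haarScalarFactor coneMeasure (Measure.haar : Measure SL(2, ℝ))
  have hc : c ≠ 0 := by
    intro hc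
    rw [h, hc] at hF
    simp at hF
  have hc' : (c : ℝ≥0∞) ≠ 0 := by exact_mod_cast hc
  rw [h]
  simp only [Measure.smul_apply, ENNReal.smul_def, smul_eq_mul]
  rw [ENNReal.mul_inv (Or.inl hc') (Or.inl ENNReal.coe_ne_top), mul_mul_mul_comm,
    ENNReal.inv_mul_cancel hc' ENNReal.coe_ne_top, one_mul]

/-! ### The cone measure of a box -/

lemma lintegral_Ioc_ofReal_id : ∫⁻ δ in Ioc (0 : ℝ) 1, ENNReal.ofReal δ = ENNReal.ofReal (1 / 2) := by
  rw [← ofReal_integral_eq_lintegral_ofReal]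
  · rw [← intervalIntegral.integral_of_le zero_le_one, integral_id]
    norm_num
  · exact (continuous_id.integrableOn_Icc).mono_set Ioc_subset_Icc_self
  · filter_upwards [ae_restrict_mem measurableSet_Ioc] with x hx using hx.1.le

/-- For a fixed first column `f`, replace the second column `z` by `z.1 / f.1` and the determinant
`δ`, a change of variables of Jacobian one. The first variable ranges over an interval of length
`a`; for fixed `δ`, `f` ranges over `√δ K`, of area `δ |K|`, and `∫₀¹ δ dδ = 1/2`. -/
lemma coneMeasure_box {K : Set (ℝ × ℝ)} (hK : IsClosed K) (hpos : ∀ z ∈ K, 0 < z.1) {a : ℝ}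
    (ha : 0 < a) :
    coneMeasure {g | (g 0 0, g 1 0) ∈ K ∧ |g 0 1| ≤ a / 2 * g 0 0} =
      ENNReal.ofReal (a / 2) * volume K := by
  have hmeas : MeasurableSet {g : SL(2, ℝ) | (g 0 0, g 1 0) ∈ K ∧ |g 0 1| ≤ a / 2 * g 0 0} := by
    refine (IsClosed.inter (hK.preimage
      ((continuous_slEntry 0 0).prodMk (continuous_slEntry 1 0)))
      (isClosed_le (continuous_slEntry 0 1).abs
        (continuous_const.mul (continuous_slEntry 0 0)))).measurableSet
  rw [coneMeasure_apply hmeas]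
  set E : Set ((ℝ × ℝ) × ℝ) := {w | w.2 ∈ Ioc 0 1 ∧ (√w.2)⁻¹ • w.1 ∈ K} with hE
  have hEm : MeasurableSet E := by
    refine (measurable_snd measurableSet_Ioc).inter ?_
    exact (measurable_snd.sqrt.inv.smul measurable_fst) hK.measurableSet
  have hset : ∀ f : ℝ × ℝ, volume (Prod.mk f ⁻¹' (normalizeSL ⁻¹' {g : SL(2, ℝ) |
      (g 0 0, g 1 0) ∈ K ∧ |g 0 1| ≤ a / 2 * g 0 0} ∩ detCone)) =
      ENNReal.ofReal a * volume (Prod.mk f ⁻¹' E) := by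
    intro f
    have hiff : ∀ z : ℝ × ℝ, (f, z) ∈ normalizeSL ⁻¹' {g : SL(2, ℝ) |
        (g 0 0, g 1 0) ∈ K ∧ |g 0 1| ≤ a / 2 * g 0 0} ∩ detCone ↔
        (f, f.1 * z.2 - f.2 * z.1) ∈ E ∧ |z.1| ≤ a / 2 * f.1 := by
      intro z
      have hd : f.1 * z.2 - f.2 * z.1 = colDet (f, z) := rfl
      rw [hd]
      simp only [hE, mem_inter_iff, mem_preimage, mem_ofPred_eq, detCone]
      by_cases h : colDet (f, z) ∈ Ioc 0 1
      · obtain ⟨a1, a2, a3, a4⟩ := normalizeSL_apply h.1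
        have hs := Real.sqrt_pos.2 h.1
        rw [a1, a2, a3, abs_div, abs_of_pos hs, ← mul_div_assoc, div_le_div_iff_of_pos_right hs]
        have : (√(colDet (f, z)))⁻¹ • f = (f.1 / √(colDet (f, z)), f.2 / √(colDet (f, z))) := by
          ext <;> simp [div_eq_inv_mul]
        rw [this]
        tauto
      · tauto
    rcases le_or_gt f.1 0 with hf | hf
    · have hEe : ∀ δ, (f, δ) ∉ E := by
        rintro δ ⟨hδ, hK'⟩
        have := hpos _ hK'
        have hs := inv_pos.2 (Real.sqrt_pos.2 hδ.1)
        simp only [Prod.smul_fst, smul_eq_mul] at this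
        nlinarith
      have h1 : Prod.mk f ⁻¹' E = ∅ := by
        ext δ; simp [hEe]
      rw [h1, measure_empty, mul_zero]
      convert measure_empty (μ := (volume : Measure (ℝ × ℝ)))
      ext z
      rw [mem_preimage, hiff]
      simp [hEe]
    · have h1 : Prod.mk f ⁻¹' (normalizeSL ⁻¹' {g : SL(2, ℝ) |
        (g 0 0, g 1 0) ∈ K ∧ |g 0 1| ≤ a / 2 * g 0 0} ∩ detCone) =
          planeMap (1 / f.1) 0 (-f.2) f.1 ⁻¹' (Icc (-(a / 2)) (a / 2) ×ˢ (Prod.mk f ⁻¹' E)) := by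
        ext z
        rw [mem_preimage, hiff, mem_preimage, mem_prod, and_comm, mem_preimage]
        simp only [planeMap]
        refine and_congr ?_ ?_
        · rw [mem_Icc, ← abs_le, zero_mul, add_zero, abs_mul, abs_of_pos (one_div_pos.2 hf),
            one_div, inv_mul_le_iff₀ hf, mul_comm]
        · rw [show f.1 * z.2 - f.2 * z.1 = -f.2 * z.1 + f.1 * z.2 by ring]
      have hdet : 1 / f.1 * f.1 - 0 * (-f.2) = 1 := by field_simp; ring
      rw [h1, volume_preimage_planeMap (by rw [hdet]; exact one_ne_zero), hdet,
        Measure.volume_eq_prod, Measure.prod_prod, Real.volume_Icc]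
      simp
  have hmeas' := (measurable_normalizeSL hmeas).inter measurableSet_detCone
  rw [Measure.volume_eq_prod, Measure.prod_apply hmeas']
  simp_rw [hset]
  rw [lintegral_const_mul _ (measurable_measure_prodMk_left hEm), ← Measure.prod_apply hEm,
    Measure.prod_apply_symm hEm]
  have hslice : ∀ δ : ℝ, volume ((fun f : ℝ × ℝ => (f, δ)) ⁻¹' E) =
      (Ioc (0 : ℝ) 1).indicator (fun δ => ENNReal.ofReal δ * volume K) δ := by
    intro δ
    by_cases h : δ ∈ Ioc (0 : ℝ) 1
    · rw [indicator_of_mem h]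
      have hs := Real.sqrt_pos.2 h.1
      have : (fun f : ℝ × ℝ => (f, δ)) ⁻¹' E = (fun f => (√δ)⁻¹ • f) ⁻¹' K := by
        ext f
        exact ⟨fun hf => hf.2, fun hf => ⟨h, hf⟩⟩
      rw [this, preimage_smul_inv₀ hs.ne', Measure.addHaar_smul_of_nonneg _ hs.le]
      simp [Real.sq_sqrt h.1.le]
    · rw [indicator_of_notMem h]
      convert measure_empty (μ := (volume : Measure (ℝ × ℝ)))
      ext f
      exact ⟨fun hf => h hf.1, fun hf => hf.elim⟩
  simp_rw [hslice]
  rw [lintegral_indicator measurableSet_Ioc, lintegral_mul_const _ ENNReal.measurable_ofReal,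
    lintegral_Ioc_ofReal_id, ← mul_assoc, ← ENNReal.ofReal_mul ha.le, mul_one_div]

/-! ### The cone measure of a right `SO(2)`-invariant set -/

/-- Real and imaginary part of the image of `i` under a matrix of determinant `1`. -/
def imageOfI (g : SL(2, ℝ)) : ℝ × ℝ := ((g • UpperHalfPlane.I).re, (g • UpperHalfPlane.I).im)

lemma imageOfI_eq (g : SL(2, ℝ)) : imageOfI g =
    ((g 0 0 * g 1 0 + g 0 1 * g 1 1) / (g 1 0 ^ 2 + g 1 1 ^ 2), 1 / (g 1 0 ^ 2 + g 1 1 ^ 2)) := by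
  have h := UpperHalfPlane.coe_specialLinearGroup_apply g UpperHalfPlane.I
  have hd := sl_det g
  simp only [Algebra.algebraMap_self, RingHom.id_apply, UpperHalfPlane.coe_I] at h
  have hre := congrArg Complex.re h
  have him := congrArg Complex.im h
  rw [UpperHalfPlane.coe_re] at hre
  rw [UpperHalfPlane.coe_im] at him
  simp only [imageOfI, hre, him, Complex.div_re, Complex.div_im, Complex.normSq_apply]
  simp
  constructor
  · ring
  · linear_combination (g 1 0 ^ 2 + g 1 1 ^ 2)⁻¹ * hd

lemma continuous_imageOfI : Continuous imageOfI := by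
  have hne : ∀ g : SL(2, ℝ), g 1 0 ^ 2 + g 1 1 ^ 2 ≠ 0 := by
    intro g h
    have h0 : g 1 0 = 0 := by nlinarith [sq_nonneg (g 1 0), sq_nonneg (g 1 1)]
    have h1 : g 1 1 = 0 := by nlinarith [sq_nonneg (g 1 0), sq_nonneg (g 1 1)]
    have := sl_det g
    rw [h0, h1] at this
    simp at this
  simp_rw [funext imageOfI_eq]
  have := continuous_slEntry
  exact ((((this 0 0).mul (this 1 0)).add ((this 0 1).mul (this 1 1))).div₀
    (((this 1 0).pow 2).add ((this 1 1).pow 2)) hne).prodMk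
    (continuous_const.div₀ (((this 1 0).pow 2).add ((this 1 1).pow 2)) hne)

/-- This passes from columns to rows: the image of `i` is linear in the top row once the bottom row
is fixed and the determinant is not normalised. -/
lemma measurePreserving_transpose :
    MeasurePreserving (fun w : (ℝ × ℝ) × (ℝ × ℝ) => ((w.1.1, w.2.1), (w.1.2, w.2.2))) := by
  have h1 : MeasurePreserving (MeasurableEquiv.prodAssoc : (ℝ × ℝ) × (ℝ × ℝ) ≃ᵐ _) :=
    volume_preserving_prodAssoc
  have h2 : MeasurePreserving (MeasurableEquiv.prodAssoc : (ℝ × ℝ) × ℝ ≃ᵐ _).symm :=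
    (volume_preserving_prodAssoc (α₁ := ℝ) (β₁ := ℝ) (γ₁ := ℝ)).symm _
  have h3 : MeasurePreserving (Prod.swap : ℝ × ℝ → ℝ × ℝ) := Measure.measurePreserving_swap
  have hid : MeasurePreserving (id : ℝ → ℝ) := MeasurePreserving.id _
  have h4 := hid.prod (((volume_preserving_prodAssoc (α₁ := ℝ) (β₁ := ℝ) (γ₁ := ℝ)).comp
    (h3.prod hid)).comp h2)
  exact ((volume_preserving_prodAssoc (α₁ := ℝ) (β₁ := ℝ) (γ₁ := ℝ × ℝ)).symm _).comp (h4.comp h1)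

/-- In polar coordinates this is `2π ∫ r³ dr` over `0 < r ≤ y^{-1/2}`. It is the integral over
bottom rows `q` left after the top row has been integrated out. -/
lemma lintegral_normSq_disc {y : ℝ} (hy : 0 < y) :
    ∫⁻ q : ℝ × ℝ, ENNReal.ofReal (q.1 ^ 2 + q.2 ^ 2) *
      (if y * (q.1 ^ 2 + q.2 ^ 2) ≤ 1 then 1 else 0) =
      ENNReal.ofReal (Real.pi / 2 * (y ^ 2)⁻¹) := by
  rw [← lintegral_comp_polarCoord_symm]
  set R := 1 / √y with hR
  have hsy : 0 < √y := Real.sqrt_pos.2 hy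
  have hR0 : 0 < R := by positivity
  have hf : ∀ p ∈ polarCoord.target, ENNReal.ofReal p.1 •
      (ENNReal.ofReal ((polarCoord.symm p).1 ^ 2 + (polarCoord.symm p).2 ^ 2) *
        (if y * ((polarCoord.symm p).1 ^ 2 + (polarCoord.symm p).2 ^ 2) ≤ 1 then 1 else 0)) =
      (Ioc 0 R).indicator (fun r => ENNReal.ofReal (r ^ 3)) p.1 * 1 := by
    rintro ⟨r, θ⟩ hp
    have hr : 0 < r := hp.1
    have e : (r * Real.cos θ) ^ 2 + (r * Real.sin θ) ^ 2 = r ^ 2 := by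
      linear_combination r ^ 2 * Real.sin_sq_add_cos_sq θ
    simp only [polarCoord_symm_apply, e, smul_eq_mul, mul_one]
    have hc : y * r ^ 2 ≤ 1 ↔ r ≤ R := by
      rw [hR, le_div_iff₀ hsy, ← sq_le_one_iff₀ (a := r * √y) (by positivity), mul_pow, Real.sq_sqrt hy.le,
        mul_comm]
    by_cases h : r ≤ R
    · have hm : r ∈ Ioc 0 R := ⟨hr, h⟩
      rw [if_pos (hc.2 h), indicator_of_mem hm, mul_one,
        ← ENNReal.ofReal_mul hr.le]
      congr 1; ring
    · rw [if_neg (fun h' => h (hc.1 h')), indicator_of_notMem (fun h' => h h'.2), mul_zero, mul_zero]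
  rw [setLIntegral_congr_fun polarCoord.open_target.measurableSet hf, polarCoord_target,
    Measure.volume_eq_prod, ← Measure.prod_restrict,
    lintegral_prod_mul (g := fun _ => (1 : ℝ≥0∞))
      (Measurable.indicator (by fun_prop) measurableSet_Ioc).aemeasurable (by fun_prop), setLIntegral_indicator measurableSet_Ioc,
    setLIntegral_one, Real.volume_Ioo, inter_eq_self_of_subset_left Ioc_subset_Ioi_self,
    ← ofReal_integral_eq_lintegral_ofReal, ← intervalIntegral.integral_of_le hR0.le, integral_pow,
    ← ENNReal.ofReal_mul]
  · congr 1
    have h4 : √y ^ 4 = y ^ 2 := by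
      rw [show √y ^ 4 = (√y ^ 2) ^ 2 by ring, Real.sq_sqrt hy.le]
    rw [hR, div_pow, h4]
    norm_num
    ring
  · rw [zero_pow (by norm_num), sub_zero]
    positivity
  · exact (continuous_pow 3).integrableOn_Icc.mono_set Ioc_subset_Icc_self
  · filter_upwards [ae_restrict_mem measurableSet_Ioc] with x hx using pow_nonneg hx.1.le 3

/-- In the upper half plane, the cone measure projects to a multiple of the hyperbolic area. -/
theorem coneMeasure_preimage_imageOfI {S : Set (ℝ × ℝ)} (hS : MeasurableSet S)
    (hpos : ∀ z ∈ S, 0 < z.2) :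
    coneMeasure (imageOfI ⁻¹' S) = ∫⁻ z in S, ENNReal.ofReal (Real.pi / 2 * (z.2 ^ 2)⁻¹) := by
  rw [coneMeasure_apply (continuous_imageOfI.measurable hS)]
  set E : Set ((ℝ × ℝ) × (ℝ × ℝ)) := {w | w.1.1 * w.2.2 - w.1.2 * w.2.1 ∈ Ioc 0 1 ∧
    ((w.1.1 * w.2.1 + w.1.2 * w.2.2) / (w.2.1 ^ 2 + w.2.2 ^ 2),
      (w.1.1 * w.2.2 - w.1.2 * w.2.1) / (w.2.1 ^ 2 + w.2.2 ^ 2)) ∈ S} with hE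
  have hEm : MeasurableSet E := by
    refine ((by fun_prop : Measurable fun w : (ℝ × ℝ) × (ℝ × ℝ) =>
      w.1.1 * w.2.2 - w.1.2 * w.2.1) measurableSet_Ioc).inter ?_
    exact (by fun_prop : Measurable fun w : (ℝ × ℝ) × (ℝ × ℝ) =>
      ((w.1.1 * w.2.1 + w.1.2 * w.2.2) / (w.2.1 ^ 2 + w.2.2 ^ 2),
      (w.1.1 * w.2.2 - w.1.2 * w.2.1) / (w.2.1 ^ 2 + w.2.2 ^ 2))) hS
  have hpre : normalizeSL ⁻¹' (imageOfI ⁻¹' S) ∩ detCone =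
      (fun w : (ℝ × ℝ) × (ℝ × ℝ) => ((w.1.1, w.2.1), (w.1.2, w.2.2))) ⁻¹' E := by
    ext ⟨⟨x1, y1⟩, ⟨x2, y2⟩⟩
    simp only [hE, mem_inter_iff, mem_preimage, mem_ofPred_eq, detCone, imageOfI_eq]
    by_cases h : colDet ((x1, y1), (x2, y2)) ∈ Ioc 0 1
    · obtain ⟨a1, a2, a3, a4⟩ := normalizeSL_apply h.1
      have hs := (Real.sqrt_pos.2 h.1).ne'
      have hs2 := Real.sq_sqrt h.1.le
      have e : colDet ((x1, y1), (x2, y2)) = x1 * y2 - x2 * y1 := by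
        simp [colDet]; ring
      rw [a1, a2, a3, a4]
      have hne : y1 ^ 2 + y2 ^ 2 ≠ 0 := by
        intro h0
        have h1 := h.1
        have hy1 : y1 = 0 := by nlinarith [sq_nonneg y1, sq_nonneg y2]
        have hy2 : y2 = 0 := by nlinarith [sq_nonneg y1, sq_nonneg y2]
        rw [e, hy1, hy2] at h1
        simp at h1
      rw [← e]
      simp only [h, and_true, true_and]
      have e1 : ((x1 / √(colDet ((x1, y1), (x2, y2)))) * (y1 / √(colDet ((x1, y1), (x2, y2)))) +
          (x2 / √(colDet ((x1, y1), (x2, y2)))) * (y2 / √(colDet ((x1, y1), (x2, y2))))) /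
          ((y1 / √(colDet ((x1, y1), (x2, y2)))) ^ 2 + (y2 / √(colDet ((x1, y1), (x2, y2)))) ^ 2) =
          (x1 * y1 + x2 * y2) / (y1 ^ 2 + y2 ^ 2) := by
        field_simp
      have e2 : 1 / ((y1 / √(colDet ((x1, y1), (x2, y2)))) ^ 2 +
          (y2 / √(colDet ((x1, y1), (x2, y2)))) ^ 2) =
          colDet ((x1, y1), (x2, y2)) / (y1 ^ 2 + y2 ^ 2) := by
        rw [div_pow, div_pow, hs2, ← add_div, one_div_div]
      rw [e1, e2]
    · have h' : ¬ x1 * y2 - x2 * y1 ∈ Ioc (0 : ℝ) 1 := by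
        have e : colDet ((x1, y1), (x2, y2)) = x1 * y2 - x2 * y1 := by
          simp [colDet]; ring
        rwa [e] at h
      tauto
  rw [hpre, measurePreserving_transpose.measure_preimage hEm.nullMeasurableSet,
    Measure.volume_eq_prod, Measure.prod_apply_symm hEm]
  -- For a fixed bottom row `q`, the top row goes to the image of `i` by a linear map of determinant
  -- `-1/|q|²`, and the determinant of the matrix is the height times `|q|²`.
  have hslice : ∀ q : ℝ × ℝ, volume ((fun p : ℝ × ℝ => (p, q)) ⁻¹' E) =
      ∫⁻ z in S, ENNReal.ofReal (q.1 ^ 2 + q.2 ^ 2) *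
        (if z.2 * (q.1 ^ 2 + q.2 ^ 2) ≤ 1 then 1 else 0) := by
    intro q
    set n := q.1 ^ 2 + q.2 ^ 2 with hn
    have hmle : MeasurableSet {z : ℝ × ℝ | z.2 * n ≤ 1} :=
      measurableSet_le (by fun_prop) (by fun_prop)
    have hrhs : ∫⁻ z in S, ENNReal.ofReal n * (if z.2 * n ≤ 1 then 1 else 0) =
        ENNReal.ofReal n * volume ({z | z.2 * n ≤ 1} ∩ S) := by
      rw [lintegral_const_mul _ (Measurable.ite hmle measurable_const measurable_const)]
      congr 1
      rw [← Measure.restrict_apply hmle, ← lintegral_indicator_one hmle]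
      rfl
    rw [hrhs]
    have hn0 : 0 ≤ n := by positivity
    rcases hn0.eq_or_lt with h0 | h0
    · have hq1 : q.1 = 0 := by nlinarith [sq_nonneg q.1, sq_nonneg q.2]
      have hq2 : q.2 = 0 := by nlinarith [sq_nonneg q.1, sq_nonneg q.2]
      rw [← h0, ENNReal.ofReal_zero, zero_mul]
      convert measure_empty (μ := (volume : Measure (ℝ × ℝ)))
      ext p
      simp [hE, hq1, hq2]
    · have hset : (fun p : ℝ × ℝ => (p, q)) ⁻¹' E =
          planeMap (q.1 / n) (q.2 / n) (q.2 / n) (-q.1 / n) ⁻¹' ({z | z.2 * n ≤ 1} ∩ S) := by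
        ext p
        have e : planeMap (q.1 / n) (q.2 / n) (q.2 / n) (-q.1 / n) p =
          ((p.1 * q.1 + p.2 * q.2) / n, (p.1 * q.2 - p.2 * q.1) / n) := by
          simp only [planeMap]
          ext <;> simp only [] <;> ring
        simp only [mem_preimage, e, hE, mem_ofPred_eq, mem_inter_iff, ← hn, mem_Ioc,
          div_mul_cancel₀ _ h0.ne']
        constructor
        · rintro ⟨⟨_, h1⟩, h2⟩; exact ⟨h1, h2⟩
        · rintro ⟨h1, h2⟩
          have := hpos _ h2
          exact ⟨⟨(div_pos_iff_of_pos_right h0).1 this, h1⟩, h2⟩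
      have hdet : q.1 / n * (-q.1 / n) - q.2 / n * (q.2 / n) = -n⁻¹ := by
        field_simp
        rw [hn]; ring
      have hninv : 0 < n⁻¹ := inv_pos.2 h0
      rw [hset, volume_preimage_planeMap (by rw [hdet]; exact (neg_lt_zero.2 hninv).ne), hdet,
        abs_inv, abs_neg, abs_of_pos hninv, inv_inv]
  simp_rw [hslice]
  rw [lintegral_lintegral_swap]
  · refine setLIntegral_congr_fun hS fun z hz => ?_
    exact lintegral_normSq_disc (hpos z hz)
  · refine Measurable.aemeasurable ?_
    refine Measurable.mul (by fun_prop) (Measurable.ite ?_ measurable_const measurable_const)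
    exact measurableSet_le (by fun_prop) (by fun_prop)

/-! ### The fundamental domain -/

/-- The closed standard fundamental domain, in real coordinates. -/
def planeFd : Set (ℝ × ℝ) := {z | 0 < z.2 ∧ 1 ≤ z.1 ^ 2 + z.2 ^ 2 ∧ |z.1| ≤ 1 / 2}

/-- The open standard fundamental domain, in real coordinates. -/
def planeFdo : Set (ℝ × ℝ) := {z | 0 < z.2 ∧ 1 < z.1 ^ 2 + z.2 ^ 2 ∧ |z.1| < 1 / 2}

lemma measurableSet_planeFd : MeasurableSet planeFd := by
  simp only [planeFd, ofPred_and]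
  exact (measurableSet_lt (by fun_prop) (by fun_prop)).inter
    ((measurableSet_le (by fun_prop) (by fun_prop)).inter
      (measurableSet_le (by fun_prop) (by fun_prop)))

lemma measurableSet_planeFdo : MeasurableSet planeFdo := by
  simp only [planeFdo, ofPred_and]
  exact (measurableSet_lt (by fun_prop) (by fun_prop)).inter
    ((measurableSet_lt (by fun_prop) (by fun_prop)).inter
      (measurableSet_lt (by fun_prop) (by fun_prop)))

lemma imageOfI_mem_planeFd (g : SL(2, ℝ)) : imageOfI g ∈ planeFd ↔
    g • UpperHalfPlane.I ∈ ModularGroup.fd := by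
  simp only [planeFd, imageOfI, ModularGroup.fd, mem_ofPred_eq, Complex.normSq_apply,
    UpperHalfPlane.coe_re, UpperHalfPlane.coe_im, (g • UpperHalfPlane.I).im_pos, true_and, pow_two]

lemma imageOfI_mem_planeFdo (g : SL(2, ℝ)) : imageOfI g ∈ planeFdo ↔
    g • UpperHalfPlane.I ∈ ModularGroup.fdo := by
  simp only [planeFdo, imageOfI, ModularGroup.fdo, mem_ofPred_eq, Complex.normSq_apply,
    UpperHalfPlane.coe_re, UpperHalfPlane.coe_im, (g • UpperHalfPlane.I).im_pos, true_and, pow_two]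

lemma volume_planeFd_diff : volume (planeFd \ planeFdo) = 0 := by
  have hsub : planeFd \ planeFdo ⊆ ({1 / 2, -(1 / 2)} : Set ℝ) ×ˢ (univ : Set ℝ) ∪
      {z : ℝ × ℝ | 0 < z.2 ∧ z.1 ^ 2 + z.2 ^ 2 = 1} := by
    rintro z ⟨⟨h0, h1, h2⟩, h3⟩
    by_cases h : |z.1| = 1 / 2
    · left
      exact ⟨(abs_eq (by norm_num)).1 h, mem_univ _⟩
    · right
      refine ⟨h0, le_antisymm ?_ h1⟩
      by_contra h4
      exact h3 ⟨h0, not_le.1 h4, lt_of_le_of_ne h2 h⟩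
  refine measure_mono_null hsub (measure_union_null ?_ ?_)
  · rw [Measure.volume_eq_prod, Measure.prod_prod, (Set.toFinite _).measure_zero]
    simp
  · have hm : MeasurableSet {z : ℝ × ℝ | 0 < z.2 ∧ z.1 ^ 2 + z.2 ^ 2 = 1} := by
      simp only [ofPred_and]
      exact (measurableSet_lt (by fun_prop) (by fun_prop)).inter
        (measurableSet_eq_fun (by fun_prop) (by fun_prop))
    rw [Measure.volume_eq_prod, Measure.measure_prod_null hm]
    refine Filter.Eventually.of_forall fun x => ?_
    refine Set.Subsingleton.measure_zero ?_ _
    rintro a ⟨ha, ha'⟩ b ⟨hb, hb'⟩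
    simp only at ha ha' hb hb'
    nlinarith

lemma lintegral_Ici_inv_sq {c : ℝ} (hc : 0 < c) :
    ∫⁻ y in Ici c, ENNReal.ofReal (Real.pi / 2 * (y ^ 2)⁻¹) = ENNReal.ofReal (Real.pi / 2 * c⁻¹) := by
  rw [setLIntegral_congr Ioi_ae_eq_Ici.symm]
  have hrp : ∀ y ∈ Ioi c, y ^ (-2 : ℝ) = (y ^ 2)⁻¹ := by
    intro y hy
    rw [Real.rpow_neg (hc.trans hy).le]
    norm_cast
  have hint : IntegrableOn (fun y : ℝ => (y ^ 2)⁻¹) (Ioi c) :=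
    (integrableOn_Ioi_rpow_of_lt (by norm_num) hc).congr_fun hrp measurableSet_Ioi
  have hval : ∫ y in Ioi c, (y ^ 2)⁻¹ = c⁻¹ := by
    rw [← setIntegral_congr_fun measurableSet_Ioi hrp, integral_Ioi_rpow_of_lt (by norm_num) hc]
    norm_num
    rw [Real.rpow_neg_one]
  rw [← ofReal_integral_eq_lintegral_ofReal (hint.const_mul _)
    (Filter.Eventually.of_forall fun y => by positivity), integral_const_mul, hval]

/-- This is `π/2` times the hyperbolic area `π/3`: integrating `y⁻²` above the unit circle leaves
`(1 - x²)^{-1/2}`, whose primitive is `arcsin`. -/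
theorem coneMeasure_fundDomain : coneMeasure fundDomain = ENNReal.ofReal (Real.pi ^ 2 / 6) := by
  have hF : fundDomain = imageOfI ⁻¹' planeFd := by
    ext g; exact (imageOfI_mem_planeFd g).symm
  rw [hF, coneMeasure_preimage_imageOfI measurableSet_planeFd (fun z hz => hz.1),
    ← lintegral_indicator measurableSet_planeFd, Measure.volume_eq_prod,
    lintegral_prod _ (Measurable.aemeasurable
      (Measurable.indicator (by fun_prop) measurableSet_planeFd))]
  have hslice : ∀ x : ℝ, ∫⁻ y, planeFd.indicator
      (fun z : ℝ × ℝ => ENNReal.ofReal (Real.pi / 2 * (z.2 ^ 2)⁻¹)) (x, y) =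
      (Icc (-(1 / 2)) (1 / 2)).indicator
        (fun x : ℝ => ENNReal.ofReal (Real.pi / 2 * (√(1 - x ^ 2))⁻¹)) x := by
    intro x
    by_cases hx : x ∈ Icc (-(1 / 2) : ℝ) (1 / 2)
    · have hx1 : 0 < 1 - x ^ 2 := by
        have := abs_le.2 hx
        have := sq_le_sq' hx.1 hx.2
        linarith
      have hs := Real.sqrt_pos.2 hx1
      rw [indicator_of_mem hx, ← lintegral_Ici_inv_sq hs, ← lintegral_indicator measurableSet_Ici]
      congr 1
      ext1 y
      have : (x, y) ∈ planeFd ↔ y ∈ Ici (√(1 - x ^ 2)) := by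
        simp only [planeFd, mem_ofPred_eq, mem_Ici, abs_le.2 hx, and_true]
        constructor
        · rintro ⟨h0, h1⟩
          exact Real.sqrt_le_iff.2 ⟨h0.le, by linarith⟩
        · intro h
          refine ⟨hs.trans_le h, ?_⟩
          have := (Real.sqrt_le_left (hs.trans_le h).le).1 h
          linarith
      by_cases h : y ∈ Ici (√(1 - x ^ 2))
      · rw [indicator_of_mem h, indicator_of_mem (this.2 h)]
      · rw [indicator_of_notMem h, indicator_of_notMem (fun h' => h (this.1 h'))]
    · rw [indicator_of_notMem hx]
      have : ∀ y, (x, y) ∉ planeFd := fun y h => hx (abs_le.1 h.2.2)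
      simp [this]
  simp_rw [hslice]
  rw [lintegral_indicator measurableSet_Icc, setLIntegral_congr Ioc_ae_eq_Icc.symm]
  have hcont : ContinuousOn (fun x : ℝ => Real.pi / 2 * (√(1 - x ^ 2))⁻¹)
      (uIcc (-(1 / 2)) (1 / 2)) := by
    refine continuousOn_const.mul (ContinuousOn.inv₀ (by fun_prop) fun x hx => ?_)
    rw [uIcc_of_le (by norm_num)] at hx
    have := sq_le_sq' hx.1 hx.2
    exact (Real.sqrt_pos.2 (by linarith)).ne'
  rw [← ofReal_integral_eq_lintegral_ofReal, ← intervalIntegral.integral_of_le (by norm_num)]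
  · congr 1
    rw [intervalIntegral.integral_eq_sub_of_hasDerivAt
      (f := fun x => Real.pi / 2 * Real.arcsin x) _ hcont.intervalIntegrable]
    · have h6 : Real.arcsin (1 / 2) = Real.pi / 6 := by
        rw [← Real.sin_pi_div_six]
        exact Real.arcsin_sin (by linarith [Real.pi_pos]) (by linarith [Real.pi_pos])
      rw [Real.arcsin_neg, h6]
      ring
    · intro x hx
      rw [uIcc_of_le (by norm_num)] at hx
      have := (Real.hasDerivAt_arcsin (x := x) (by linarith [hx.1]) (by linarith [hx.2])).const_mul
        (Real.pi / 2)
      simpa [one_div] using this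
  · rw [uIcc_of_le (by norm_num)] at hcont
    exact hcont.integrableOn_Icc.mono_set Ioc_subset_Icc_self
  · exact Filter.Eventually.of_forall fun x => by positivity

lemma coneMeasure_boundary : coneMeasure (imageOfI ⁻¹' (planeFd \ planeFdo)) = 0 := by
  rw [coneMeasure_preimage_imageOfI (measurableSet_planeFd.diff measurableSet_planeFdo)
    (fun z hz => hz.1.1)]
  exact setLIntegral_measure_zero _ _ volume_planeFd_diff

/-! ### Coordinates of boxes -/

/-- The set of first columns of the matrices in a box. -/
def boxSector (x : SL(2, ℝ)) (b c : ℝ) : Set (ℝ × ℝ) :=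
  sector (x 0 0, x 1 0) (x 0 1, x 1 1) (Real.exp (-(b / 4))) (Real.exp (b / 4)) (c / 2)

lemma mul_entry (g h : SL(2, ℝ)) (i j : Fin 2) : (g * h) i j = g i 0 * h 0 j + g i 1 * h 1 j := by
  rw [Matrix.SpecialLinearGroup.coe_mul, Matrix.mul_apply, Fin.sum_univ_two]

lemma sl_ext {g h : SL(2, ℝ)} (h00 : g 0 0 = h 0 0) (h01 : g 0 1 = h 0 1) (h10 : g 1 0 = h 1 0)
    (h11 : g 1 1 = h 1 1) : g = h := by
  ext i j
  fin_cases i <;> fin_cases j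
  exacts [h00, h01, h10, h11]

@[simp] lemma upperMat_entries (u : ℝ) : upperMat u 0 0 = 1 ∧ upperMat u 0 1 = u ∧
    upperMat u 1 0 = 0 ∧ upperMat u 1 1 = 1 := by
  simp [upperMat]

@[simp] lemma lowerMat_entries (u : ℝ) : lowerMat u 0 0 = 1 ∧ lowerMat u 0 1 = 0 ∧
    lowerMat u 1 0 = u ∧ lowerMat u 1 1 = 1 := by
  simp [lowerMat]

@[simp] lemma diagMat_entries (t : ℝ) : diagMat t 0 0 = Real.exp (t / 2) ∧ diagMat t 0 1 = 0 ∧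
    diagMat t 1 0 = 0 ∧ diagMat t 1 1 = Real.exp (-(t / 2)) := by
  simp [diagMat]

lemma lower_diag_upper_entries (x : SL(2, ℝ)) (u t v : ℝ) (i : Fin 2) :
    (x * lowerMat u * diagMat t * upperMat v) i 0 = Real.exp (t / 2) * (x i 0 + u * x i 1) ∧
    (x * lowerMat u * diagMat t * upperMat v) i 1 =
      v * Real.exp (t / 2) * (x i 0 + u * x i 1) + Real.exp (-(t / 2)) * x i 1 := by
  obtain ⟨a1, a2, a3, a4⟩ := upperMat_entries v
  obtain ⟨b1, b2, b3, b4⟩ := lowerMat_entries u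
  obtain ⟨c1, c2, c3, c4⟩ := diagMat_entries t
  constructor <;> simp only [mul_entry, a1, a2, a3, a4, b1, b2, b3, b4, c1, c2, c3, c4] <;> ring

/-- In the basis of columns of `x`, the first column of `g` has coordinates `α = e^{t/2}` and `β =
uα`, and the second column has first coordinate `η = vα`. Conversely `t = 2 log α`, `u = β/α`, `v =
η/α`, and the determinant fixes the last coordinate. -/
lemma mem_standardBox_iff {x g : SL(2, ℝ)} {a b c : ℝ} :
    g ∈ standardBox x a b c ↔ (g 0 0, g 1 0) ∈ boxSector x b c ∧
      |x 1 1 * g 0 1 - x 0 1 * g 1 1| ≤ a / 2 * (x 1 1 * g 0 0 - x 0 1 * g 1 0) := by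
  have hx := sl_det x
  have hg := sl_det g
  constructor
  · rintro ⟨_, ⟨u, hu, t, ht, rfl⟩, v, hv, rfl⟩
    simp only [unstableFlow, geodesicFlow, stableFlow] at hg ⊢
    obtain ⟨e00, e01⟩ := lower_diag_upper_entries x u t v 0
    obtain ⟨e10, e11⟩ := lower_diag_upper_entries x u t v 1
    have hE := Real.exp_pos (t / 2)
    have hα : Real.exp (t / 2) * (x 0 0 + u * x 0 1) * x 1 1 -
        Real.exp (t / 2) * (x 1 0 + u * x 1 1) * x 0 1 = Real.exp (t / 2) := by
      linear_combination Real.exp (t / 2) * hx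
    have hβ : x 0 0 * (Real.exp (t / 2) * (x 1 0 + u * x 1 1)) -
        x 1 0 * (Real.exp (t / 2) * (x 0 0 + u * x 0 1)) = u * Real.exp (t / 2) := by
      linear_combination u * Real.exp (t / 2) * hx
    have hγ : x 1 1 * (v * Real.exp (t / 2) * (x 0 0 + u * x 0 1) + Real.exp (-(t / 2)) * x 0 1) -
        x 0 1 * (v * Real.exp (t / 2) * (x 1 0 + u * x 1 1) + Real.exp (-(t / 2)) * x 1 1) =
        v * Real.exp (t / 2) := by
      linear_combination v * Real.exp (t / 2) * hx
    have hα' : x 1 1 * (Real.exp (t / 2) * (x 0 0 + u * x 0 1)) -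
        x 0 1 * (Real.exp (t / 2) * (x 1 0 + u * x 1 1)) = Real.exp (t / 2) := by
      linear_combination Real.exp (t / 2) * hx
    rw [e00, e01, e10, e11]
    simp only [boxSector, sector, mem_ofPred_eq, hα, hβ, hγ, hα', abs_mul, abs_of_pos hE]
    refine ⟨⟨Real.exp_le_exp.2 (by linarith [ht.1]), Real.exp_le_exp.2 (by linarith [ht.2]),
      mul_le_mul_of_nonneg_right (abs_le.2 hu) hE.le⟩,
      mul_le_mul_of_nonneg_right (abs_le.2 hv) hE.le⟩
  · rintro ⟨⟨h0, h1, h2⟩, h3⟩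
    simp only at h0 h1 h2
    have hβ : g 0 0 * x 1 1 - g 1 0 * x 0 1 = x 1 1 * g 0 0 - x 0 1 * g 1 0 := by ring
    rw [hβ] at h0 h1 h2
    set α := x 1 1 * g 0 0 - x 0 1 * g 1 0 with hα
    have hα0 : 0 < α := (Real.exp_pos _).trans_le h0
    set β := x 0 0 * g 1 0 - x 1 0 * g 0 0 with hβ'
    set η := x 1 1 * g 0 1 - x 0 1 * g 1 1 with hη
    have hexp : Real.exp (2 * Real.log α / 2) = α := by
      rw [mul_div_cancel_left₀ _ two_ne_zero, Real.exp_log hα0]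
    have hl0 : -(b / 4) ≤ Real.log α := (Real.le_log_iff_exp_le hα0).2 h0
    have hl1 : Real.log α ≤ b / 4 := (Real.log_le_iff_le_exp hα0).2 h1
    refine ⟨_, ⟨β / α, ?_, 2 * Real.log α, ⟨by linarith, by linarith⟩, rfl⟩, η / α, ?_, ?_⟩
    · rw [mem_Icc, ← abs_le, abs_div, abs_of_pos hα0, div_le_iff₀ hα0]; exact h2
    · rw [mem_Icc, ← abs_le, abs_div, abs_of_pos hα0, div_le_iff₀ hα0]; exact h3
    · simp only [unstableFlow, geodesicFlow, stableFlow]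
      obtain ⟨e00, e01⟩ := lower_diag_upper_entries x (β / α) (2 * Real.log α) (η / α) 0
      obtain ⟨e10, e11⟩ := lower_diag_upper_entries x (β / α) (2 * Real.log α) (η / α) 1
      rw [Real.exp_neg, hexp] at e01 e11
      rw [hexp] at e00 e10
      have k0 : α * x 0 0 + β * x 0 1 = g 0 0 := by
        rw [hα, hβ']; linear_combination g 0 0 * hx
      have k1 : α * x 1 0 + β * x 1 1 = g 1 0 := by
        rw [hα, hβ']; linear_combination g 1 0 * hx
      apply sl_ext
      · rw [e00, ← k0]; field_simp
      · rw [e01]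
        have : g 0 1 * α = η * g 0 0 + x 0 1 := by
          rw [hα, hη]; linear_combination x 0 1 * hg
        rw [eq_comm, ← mul_left_inj' hα0.ne', this, ← k0]
        field_simp
      · rw [e10, ← k1]; field_simp
      · rw [e11]
        have : g 1 1 * α = η * g 1 0 + x 1 1 := by
          rw [hα, hη]; linear_combination x 1 1 * hg
        rw [eq_comm, ← mul_left_inj' hα0.ne', this, ← k1]
        field_simp

lemma continuous_upperMat : Continuous upperMat := by
  refine Topology.IsInducing.subtypeVal.continuous_iff.2 (continuous_matrix fun i j => ?_)
  fin_cases i <;> fin_cases j <;> simp <;> fun_prop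

lemma continuous_lowerMat : Continuous lowerMat := by
  refine Topology.IsInducing.subtypeVal.continuous_iff.2 (continuous_matrix fun i j => ?_)
  fin_cases i <;> fin_cases j <;> simp <;> fun_prop

lemma continuous_diagMat : Continuous diagMat := by
  refine Topology.IsInducing.subtypeVal.continuous_iff.2 (continuous_matrix fun i j => ?_)
  fin_cases i <;> fin_cases j <;> simp <;> fun_prop

lemma standardBox_eq_image (x : SL(2, ℝ)) (a b c : ℝ) : standardBox x a b c =
    (fun s : ℝ × ℝ × ℝ => x * lowerMat s.1 * diagMat s.2.1 * upperMat s.2.2) ''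
      (Icc (-(c / 2)) (c / 2) ×ˢ Icc (-(b / 2)) (b / 2) ×ˢ Icc (-(a / 2)) (a / 2)) := by
  ext g
  constructor
  · rintro ⟨_, ⟨u, hu, t, ht, rfl⟩, v, hv, rfl⟩
    exact ⟨(u, t, v), ⟨hu, ht, hv⟩, rfl⟩
  · rintro ⟨⟨u, t, v⟩, ⟨hu, ht, hv⟩, rfl⟩
    exact ⟨_, ⟨u, hu, t, ht, rfl⟩, v, hv, rfl⟩

lemma continuous_lower_diag_upper (x : SL(2, ℝ)) : Continuous
    (fun s : ℝ × ℝ × ℝ => x * lowerMat s.1 * diagMat s.2.1 * upperMat s.2.2) :=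
  ((continuous_const.mul (continuous_lowerMat.comp continuous_fst)).mul
    (continuous_diagMat.comp (continuous_fst.comp continuous_snd))).mul
    (continuous_upperMat.comp (continuous_snd.comp continuous_snd))

lemma isCompact_standardBox (x : SL(2, ℝ)) (a b c : ℝ) : IsCompact (standardBox x a b c) := by
  rw [standardBox_eq_image]
  exact (isCompact_Icc.prod (isCompact_Icc.prod isCompact_Icc)).image (continuous_lower_diag_upper x)

lemma isPreconnected_standardBox (x : SL(2, ℝ)) (a b c : ℝ) :
    IsPreconnected (standardBox x a b c) := by
  rw [standardBox_eq_image]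
  exact (isPreconnected_Icc.prod (isPreconnected_Icc.prod isPreconnected_Icc)).image _
    (continuous_lower_diag_upper x).continuousOn

lemma mem_standardBox_mul_left (γ x g : SL(2, ℝ)) (a b c : ℝ) :
    γ * g ∈ standardBox (γ * x) a b c ↔ g ∈ standardBox x a b c := by
  simp only [standardBox_eq_image, mem_image, mul_assoc, mul_right_inj]

lemma isClosed_boxSector (x : SL(2, ℝ)) (b c : ℝ) : IsClosed (boxSector x b c) :=
  isClosed_sector _ _ _ _ _

lemma volume_boxSector (x : SL(2, ℝ)) (b c : ℝ) :
    volume (boxSector x b c) = volume (boxSector 1 b c) := by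
  have hx := sl_det x
  have h : boxSector x b c = planeMap (x 1 1) (-x 0 1) (-x 1 0) (x 0 0) ⁻¹' boxSector 1 b c := by
    ext z
    simp only [boxSector, sector, mem_ofPred_eq, mem_preimage, planeMap]
    simp
    ring_nf
    refine and_congr_left fun _ => ⟨fun h => ?_, fun h => ?_⟩ <;> linarith
  rw [h, volume_preimage_planeMap] <;>
  · rw [show x 1 1 * x 0 0 - -x 0 1 * -x 1 0 = 1 by linear_combination hx]
    simp

theorem coneMeasure_standardBox (x : SL(2, ℝ)) {a : ℝ} (ha : 0 < a) (b c : ℝ) :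
    coneMeasure (standardBox x a b c) = ENNReal.ofReal (a / 2) * volume (boxSector x b c) := by
  have h : standardBox x a b c = (fun g => x⁻¹ * g) ⁻¹' standardBox 1 a b c := by
    ext g
    rw [mem_preimage, ← mem_standardBox_mul_left x⁻¹, inv_mul_cancel]
  rw [h, measure_preimage_mul, volume_boxSector, ← coneMeasure_box (isClosed_boxSector 1 b c) _ ha]
  · congr 1
    ext g
    rw [mem_standardBox_iff]
    simp
  · intro z hz
    have h := hz.1
    simp at h
    exact (Real.exp_pos _).trans_le h

/-- Each point of the smaller trapezoid is the first column of a point in the base of the smaller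
box, where `v = 0`. -/
lemma boxSector_subset_of_standardBox_subset {x x' : SL(2, ℝ)} {a b c a' b' c' : ℝ} (ha' : 0 ≤ a')
    (h : standardBox x' a' b' c' ⊆ standardBox x a b c) :
    boxSector x' b' c' ⊆ boxSector x b c := by
  intro z hz
  set α := z.1 * x' 1 1 - z.2 * x' 0 1 with hα
  have hα0 : 0 < α := (Real.exp_pos _).trans_le hz.1
  let g : SL(2, ℝ) := ⟨!![z.1, x' 0 1 / α; z.2, x' 1 1 / α], by
    rw [Matrix.det_fin_two_of]
    field_simp
    rw [hα]; ring⟩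
  have hg : g ∈ standardBox x' a' b' c' := by
    rw [mem_standardBox_iff]
    refine ⟨hz, ?_⟩
    have h1 : x' 1 1 * g 0 1 - x' 0 1 * g 1 1 = 0 := by
      change x' 1 1 * (x' 0 1 / α) - x' 0 1 * (x' 1 1 / α) = 0
      ring
    have h2 : x' 1 1 * g 0 0 - x' 0 1 * g 1 0 = α := by
      change x' 1 1 * z.1 - x' 0 1 * z.2 = α
      rw [hα]; ring
    rw [h1, h2, abs_zero]
    positivity
  exact (mem_standardBox_iff.1 (h hg)).1

/-- The unstable segment of length `a'` through the centre `x'` keeps its first column, and with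
that column fixed the larger box allows a range of times of length only `a`. -/
lemma le_of_standardBox_subset {x x' : SL(2, ℝ)} {a b c a' b' c' : ℝ} (ha' : 0 ≤ a')
    (hb' : 0 ≤ b') (hc' : 0 ≤ c') (h : standardBox x' a' b' c' ⊆ standardBox x a b c) :
    a' ≤ a := by
  have key : ∀ v ∈ Icc (-(a' / 2)) (a' / 2), x' * upperMat v ∈ standardBox x a b c := by
    intro v hv
    refine h ⟨x', ⟨0, ⟨by linarith, by linarith⟩, 0, ⟨by linarith, by linarith⟩, ?_⟩, v, hv, rfl⟩
    have h1 : lowerMat 0 = 1 := by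
      obtain ⟨a1, a2, a3, a4⟩ := lowerMat_entries 0
      apply sl_ext <;> simp [*]
    have h2 : diagMat 0 = 1 := by
      obtain ⟨a1, a2, a3, a4⟩ := diagMat_entries 0
      apply sl_ext <;> simp [*]
    simp [geodesicFlow, stableFlow, h1, h2]
  have hcond : ∀ v ∈ Icc (-(a' / 2)) (a' / 2), 0 < x 1 1 * x' 0 0 - x 0 1 * x' 1 0 ∧
      |v * (x 1 1 * x' 0 0 - x 0 1 * x' 1 0) + (x 1 1 * x' 0 1 - x 0 1 * x' 1 1)| ≤
        a / 2 * (x 1 1 * x' 0 0 - x 0 1 * x' 1 0) := by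
    intro v hv
    obtain ⟨a1, a2, a3, a4⟩ := upperMat_entries v
    obtain ⟨hs, hle⟩ := mem_standardBox_iff.1 (key v hv)
    have hs1 := (Real.exp_pos _).trans_le hs.1
    simp only [mul_entry, a1, a2, a3, a4, mul_one, mul_zero, add_zero] at hs1 hle
    refine ⟨by linarith, ?_⟩
    convert hle using 2
    ring
  obtain ⟨hα, h1⟩ := hcond (a' / 2) ⟨by linarith, le_rfl⟩
  obtain ⟨_, h2⟩ := hcond (-(a' / 2)) ⟨le_rfl, by linarith⟩
  have h1' := (abs_le.1 h1).2
  have h2' := (abs_le.1 h2).1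
  have : a' * (x 1 1 * x' 0 0 - x 0 1 * x' 1 0) ≤ a * (x 1 1 * x' 0 0 - x 0 1 * x' 1 0) := by
    linarith
  exact le_of_mul_le_mul_right this hα

/-! ### Projections of boxes -/

/-- The inclusion of `SL(2, ℤ)` into `SL(2, ℝ)`. -/
abbrev modularMap : SL(2, ℤ) →* SL(2, ℝ) := Matrix.SpecialLinearGroup.map (Int.castRingHom ℝ)

lemma modularMap_apply (γ : SL(2, ℤ)) (i j : Fin 2) : modularMap γ i j = (γ i j : ℝ) := by
  simp [modularMap]

lemma isClosedEmbedding_modularMap : Topology.IsClosedEmbedding modularMap :=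
  Topology.IsClosedEmbedding.specialLinearGroup_map Real.isClosedEmbedding_intCast

lemma proj_eq_proj_iff {g h : SL(2, ℝ)} : proj g = proj h ↔ ∃ γ : SL(2, ℤ), modularMap γ * g = h := by
  have key : proj g = proj h ↔ g ∈ MulAction.orbit modularSubgroup h := Quotient.eq
  rw [key]
  constructor
  · rintro ⟨⟨_, γ, rfl⟩, hγ⟩
    refine ⟨γ⁻¹, ?_⟩
    rw [← hγ, map_inv]
    exact inv_mul_cancel_left _ _
  · rintro ⟨γ, rfl⟩
    have h : modularMap γ⁻¹ * (modularMap γ * g) = g := by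
      rw [map_inv]; exact inv_mul_cancel_left _ _
    exact ⟨⟨modularMap γ⁻¹, γ⁻¹, rfl⟩, h⟩

lemma proj_modularMap_mul (γ : SL(2, ℤ)) (g : SL(2, ℝ)) : proj (modularMap γ * g) = proj g :=
  (proj_eq_proj_iff.2 ⟨γ, rfl⟩).symm

lemma continuous_proj : Continuous proj := continuous_quotient_mk'

lemma proj_preimage_image (B : Set SL(2, ℝ)) :
    proj ⁻¹' (proj '' B) = ⋃ γ : SL(2, ℤ), (fun g => modularMap γ * g) ⁻¹' B := by
  ext g
  simp only [mem_preimage, mem_image, mem_iUnion]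
  constructor
  · rintro ⟨h, hB, he⟩
    obtain ⟨γ, rfl⟩ := proj_eq_proj_iff.1 he.symm
    exact ⟨γ, hB⟩
  · rintro ⟨γ, hγ⟩
    exact ⟨_, hγ, proj_modularMap_mul γ g⟩

lemma eq_of_modularMap_mul_mem {B : Set SL(2, ℝ)} (hB : InjOn proj B) {g : SL(2, ℝ)}
    {γ γ' : SL(2, ℤ)} (h : modularMap γ * g ∈ B) (h' : modularMap γ' * g ∈ B) : γ = γ' := by
  have := hB h h' (by rw [proj_modularMap_mul, proj_modularMap_mul])
  exact isClosedEmbedding_modularMap.injective (mul_right_cancel this)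

open scoped Pointwise in
-- The union is the product of a set of integral matrices, closed because `modularMap` is a closed
-- embedding of a discrete group, with a compact set.
lemma isClosed_iUnion_modularMap_preimage {B : Set SL(2, ℝ)} (hB : IsCompact B)
    (s : Set SL(2, ℤ)) : IsClosed (⋃ γ ∈ s, (fun g => modularMap γ * g) ⁻¹' B) := by
  have h : (⋃ γ ∈ s, (fun g => modularMap γ * g) ⁻¹' B) = (modularMap '' s⁻¹) * B := by
    ext g
    simp only [mem_iUnion, mem_preimage, Set.mem_mul, mem_image, Set.mem_inv, exists_prop]
    constructor
    · rintro ⟨γ, hγ, hg⟩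
      exact ⟨_, ⟨γ⁻¹, by rwa [inv_inv], rfl⟩, _, hg, by rw [map_inv, inv_mul_cancel_left]⟩
    · rintro ⟨_, ⟨γ, hγ, rfl⟩, b, hb, rfl⟩
      exact ⟨γ⁻¹, hγ, by rwa [map_inv, inv_mul_cancel_left]⟩
  rw [h]
  exact (isClosedEmbedding_modularMap.isClosedMap _ (isClosed_discrete _)).mul_right_of_isCompact hB

lemma isClosed_proj_image {B : Set SL(2, ℝ)} (hB : IsCompact B) : IsClosed (proj '' B) := by
  have hq : Topology.IsQuotientMap proj := isQuotientMap_quot_mk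
  rw [← hq.isClosed_preimage, proj_preimage_image, ← biUnion_univ]
  exact isClosed_iUnion_modularMap_preimage hB univ

/-- A preconnected set meeting an embedded compact set, and projecting into its image, is contained
in it. -/
lemma subset_of_proj_image_subset {B B' : Set SL(2, ℝ)} (hB : IsCompact B) (hinj : InjOn proj B)
    (hB' : IsPreconnected B') (hsub : proj '' B' ⊆ proj '' B) (hne : (B' ∩ B).Nonempty) :
    B' ⊆ B := by
  -- The full preimage of the image of `B` is `B` together with its nontrivial translates. Both
  -- pieces are closed, and they are disjoint because `B` is embedded, so a preconnected set stays
  -- in one of them.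
  have hcov : B' ⊆ B ∪ ⋃ γ ∈ ({1}ᶜ : Set SL(2, ℤ)), (fun g => modularMap γ * g) ⁻¹' B := by
    intro g hg
    have h : g ∈ proj ⁻¹' (proj '' B) := hsub ⟨g, hg, rfl⟩
    rw [proj_preimage_image, mem_iUnion] at h
    obtain ⟨γ, hγ⟩ := h
    by_cases h1 : γ = 1
    · left
      rw [h1, mem_preimage, map_one, one_mul] at hγ
      exact hγ
    · right
      exact mem_biUnion (show γ ∈ ({1}ᶜ : Set SL(2, ℤ)) from h1) hγ
  have hdis : Disjoint B (⋃ γ ∈ ({1}ᶜ : Set SL(2, ℤ)), (fun g => modularMap γ * g) ⁻¹' B) := by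
    rw [disjoint_left]
    intro g hg hg'
    simp only [mem_iUnion, mem_preimage, exists_prop] at hg'
    obtain ⟨γ, hγ, hγg⟩ := hg'
    exact hγ (eq_of_modularMap_mul_mem hinj hγg (γ' := 1) (by rwa [map_one, one_mul]))
  rcases isPreconnected_iff_subset_of_disjoint_closed.1 hB' _ _ hB.isClosed
    (isClosed_iUnion_modularMap_preimage hB _) hcov
    (by rw [hdis.inter_eq, inter_empty]) with h | h
  · exact h
  · obtain ⟨g, hg', hg⟩ := hne
    exact (disjoint_left.1 hdis hg (h hg')).elim

/-- If an embedded box contains the projection of another box, then it contains a translate of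
that box. -/
lemma exists_translate_standardBox_subset {x x' : SL(2, ℝ)} {a b c a' b' c' : ℝ} (ha' : 0 ≤ a')
    (hb' : 0 ≤ b') (hc' : 0 ≤ c') (hinj : InjOn proj (standardBox x a b c))
    (hinj' : InjOn proj (standardBox x' a' b' c'))
    (hsub : proj '' standardBox x' a' b' c' ⊆ proj '' standardBox x a b c) :
    ∃ x'' : SL(2, ℝ), standardBox x'' a' b' c' ⊆ standardBox x a b c ∧
      InjOn proj (standardBox x'' a' b' c') ∧
      proj '' standardBox x'' a' b' c' = proj '' standardBox x' a' b' c' := by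
  have hmem : (standardBox x' a' b' c').Nonempty :=
    ⟨_, _, ⟨0, ⟨by linarith, by linarith⟩, 0, ⟨by linarith, by linarith⟩, rfl⟩, 0,
      ⟨by linarith, by linarith⟩, rfl⟩
  obtain ⟨g, hg⟩ := hmem
  have h : g ∈ proj ⁻¹' (proj '' standardBox x a b c) := hsub ⟨g, hg, rfl⟩
  rw [proj_preimage_image, mem_iUnion] at h
  obtain ⟨γ, hγ⟩ := h
  have himage : standardBox (modularMap γ * x') a' b' c' =
      (fun g => modularMap γ * g) '' standardBox x' a' b' c' := by
    ext h
    constructor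
    · intro hh
      refine ⟨(modularMap γ)⁻¹ * h, ?_, mul_inv_cancel_left _ _⟩
      rwa [← mem_standardBox_mul_left (modularMap γ), mul_inv_cancel_left]
    · rintro ⟨h, hh, rfl⟩
      exact (mem_standardBox_mul_left _ _ _ _ _ _).2 hh
  have hproj : proj '' standardBox (modularMap γ * x') a' b' c' =
      proj '' standardBox x' a' b' c' := by
    rw [himage, image_image]
    simp only [proj_modularMap_mul]
  refine ⟨modularMap γ * x', ?_, ?_, hproj⟩
  · refine subset_of_proj_image_subset (isCompact_standardBox _ _ _ _) hinj
      (isPreconnected_standardBox _ _ _ _) (hproj ▸ hsub) ⟨modularMap γ * g, ?_, hγ⟩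
    rwa [mem_standardBox_mul_left]
  · rw [himage]
    rintro _ ⟨g₁, h₁, rfl⟩ _ ⟨g₂, h₂, rfl⟩ he
    simp only [proj_modularMap_mul] at he
    rw [hinj' h₁ h₂ he]

/-! ### The Haar measure of an embedded box -/

lemma modularMap_mul_smul_I (γ : SL(2, ℤ)) (g : SL(2, ℝ)) :
    (modularMap γ * g) • UpperHalfPlane.I = γ • (g • UpperHalfPlane.I) := by
  rw [mul_smul]
  apply UpperHalfPlane.ext
  rw [UpperHalfPlane.coe_specialLinearGroup_apply (modularMap γ),
    UpperHalfPlane.coe_specialLinearGroup_apply γ]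
  simp only [modularMap_apply, Algebra.algebraMap_self, RingHom.id_apply, algebraMap_int_eq,
    eq_intCast]

lemma measurableSet_fundDomain : MeasurableSet fundDomain := by
  have hF : fundDomain = imageOfI ⁻¹' planeFd := by
    ext g; exact (imageOfI_mem_planeFd g).symm
  rw [hF]
  exact continuous_imageOfI.measurable measurableSet_planeFd

instance : Countable SL(2, ℤ) :=
  haveI : Countable (Matrix (Fin 2) (Fin 2) ℤ) := inferInstanceAs (Countable (Fin 2 → Fin 2 → ℤ))
  Subtype.countable

/-- Almost every orbit of `SL(2, ℤ)` meets the fundamental domain in two points. -/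
lemma ae_tsum_indicator_fundDomain :
    ∀ᵐ g ∂coneMeasure, ∑' γ : SL(2, ℤ),
      fundDomain.indicator (fun _ => (1 : ℝ≥0∞)) (modularMap γ⁻¹ * g) = 2 := by
  classical
  -- Countably many translates of the null boundary are discarded.
  have hbd : ∀ᵐ g ∂coneMeasure, ∀ γ : SL(2, ℤ),
      imageOfI (modularMap γ * g) ∉ planeFd \ planeFdo := by
    rw [ae_all_iff]
    intro γ
    rw [ae_iff]
    simp only [not_not]
    have := (measurePreserving_mul_left coneMeasure (modularMap γ)).measure_preimage
      (continuous_imageOfI.measurable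
        (measurableSet_planeFd.diff measurableSet_planeFdo)).nullMeasurableSet
    rw [coneMeasure_boundary] at this
    exact this
  filter_upwards [hbd] with g hg
  obtain ⟨γ₀, hγ₀⟩ := ModularGroup.exists_smul_mem_fd (g • UpperHalfPlane.I)
  have hγ₀' : γ₀ • (g • UpperHalfPlane.I) ∈ ModularGroup.fdo := by
    have h := hg γ₀
    rw [mem_sdiff, imageOfI_mem_planeFd, imageOfI_mem_planeFdo, modularMap_mul_smul_I] at h
    by_contra h'
    exact h ⟨hγ₀, h'⟩
  have hiff : ∀ γ : SL(2, ℤ), modularMap γ⁻¹ * g ∈ fundDomain ↔ γ = γ₀⁻¹ ∨ γ = -γ₀⁻¹ := by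
    intro γ
    change (modularMap γ⁻¹ * g) • UpperHalfPlane.I ∈ ModularGroup.fd ↔ _
    rw [modularMap_mul_smul_I]
    constructor
    · intro h
      have h1 : (γ⁻¹ * γ₀⁻¹) • (γ₀ • (g • UpperHalfPlane.I)) ∈ ModularGroup.fd := by
        rwa [mul_smul, inv_smul_smul]
      rcases ModularGroup.eq_one_or_neg_one_of_mem_fdo_mem_fd hγ₀' h1 with h2 | h2
      · left
        rw [← inv_inj, inv_inv]
        exact mul_inv_eq_one.1 h2
      · right
        have : γ = γ * -(γ⁻¹ * γ₀⁻¹) * (1 : SL(2, ℤ)) := by rw [h2]; simp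
        rw [this]; simp
    · rintro (rfl | rfl)
      · rwa [inv_inv]
      · have : (-γ₀⁻¹)⁻¹ = -γ₀ := by
          rw [inv_eq_iff_mul_eq_one]; simp
        rw [this, ModularGroup.SL_neg_smul]
        exact hγ₀
  have hne : γ₀⁻¹ ≠ -γ₀⁻¹ := by
    intro h
    have h1 : (1 : SL(2, ℤ)) = -1 := by
      have := congrArg (fun γ => γ₀ * γ) h
      simpa using this
    have h2 := congrArg (fun γ : SL(2, ℤ) => γ 0 0) h1
    simp at h2
  rw [tsum_eq_sum (s := {γ₀⁻¹, -γ₀⁻¹}), Finset.sum_pair hne, indicator_of_mem, indicator_of_mem]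
  · exact one_add_one_eq_two
  · exact (hiff _).2 (Or.inr rfl)
  · exact (hiff _).2 (Or.inl rfl)
  · intro γ hγ
    rw [indicator_of_notMem]
    intro h
    exact hγ (by simpa using (hiff γ).1 h)

/-- Unfolding: the translates of `B` are disjoint, and moving each one back to `B` by invariance
turns the sum of measures into the integral over `B` of the number of orbit points in the
fundamental domain, which is almost everywhere two. -/
lemma coneMeasure_fundDomain_inter {B : Set SL(2, ℝ)} (hB : MeasurableSet B)
    (hinj : InjOn proj B) :
    coneMeasure (fundDomain ∩ proj ⁻¹' (proj '' B)) = 2 * coneMeasure B := by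
  have hmul : ∀ γ : SL(2, ℤ), Measurable fun g : SL(2, ℝ) => modularMap γ * g := fun γ =>
    measurable_const_mul _
  rw [proj_preimage_image, inter_iUnion, measure_iUnion]
  · have hterm : ∀ γ : SL(2, ℤ), coneMeasure (fundDomain ∩ (fun g => modularMap γ * g) ⁻¹' B) =
        ∫⁻ g in B, fundDomain.indicator (fun _ => (1 : ℝ≥0∞)) (modularMap γ⁻¹ * g) ∂coneMeasure := by
      intro γ
      rw [← (measurePreserving_mul_left coneMeasure (modularMap γ⁻¹)).measure_preimage
        (measurableSet_fundDomain.inter (hmul γ hB)).nullMeasurableSet]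
      have hset : (fun g => modularMap γ⁻¹ * g) ⁻¹'
          (fundDomain ∩ (fun g => modularMap γ * g) ⁻¹' B) =
          (fun g => modularMap γ⁻¹ * g) ⁻¹' fundDomain ∩ B := by
        ext g
        simp only [mem_preimage, mem_inter_iff, map_inv, mul_inv_cancel_left]
      have hm := hmul γ⁻¹ measurableSet_fundDomain
      rw [hset, ← Measure.restrict_apply hm, ← lintegral_indicator_one hm]
      rfl
    simp_rw [hterm]
    rw [← lintegral_tsum, setLIntegral_congr_fun_ae hB
      (ae_tsum_indicator_fundDomain.mono fun g hg _ => hg), setLIntegral_const]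
    intro γ
    exact ((measurable_const.indicator measurableSet_fundDomain).comp (hmul γ⁻¹)).aemeasurable
  · intro γ γ' hne
    refine disjoint_left.2 fun g hg hg' => hne ?_
    exact eq_of_modularMap_mul_mem hinj hg.2 hg'.2
  · intro γ
    exact measurableSet_fundDomain.inter (hmul γ hB)

theorem haarProb_real_box {x : SL(2, ℝ)} {a b c : ℝ} (ha : 0 < a)
    (hinj : InjOn proj (standardBox x a b c)) :
    haarProb.real (proj '' standardBox x a b c) =
      a * (volume.real (boxSector x b c) * (6 / Real.pi ^ 2)) := by
  have hpi := Real.pi_pos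
  have hclosed := isClosed_proj_image (isCompact_standardBox x a b c)
  have hF : coneMeasure fundDomain ≠ 0 := by
    rw [coneMeasure_fundDomain]
    simpa using by positivity
  rw [measureReal_def, haarProb, Measure.map_apply continuous_proj.measurable
    hclosed.measurableSet, ProbabilityTheory.cond_apply measurableSet_fundDomain,
    haar_div_eq_coneMeasure_div _ _ hF,
    coneMeasure_fundDomain_inter (isCompact_standardBox x a b c).measurableSet hinj,
    coneMeasure_standardBox x ha, coneMeasure_fundDomain, ENNReal.toReal_mul, ENNReal.toReal_mul,
    ENNReal.toReal_mul, ENNReal.toReal_inv, ENNReal.toReal_ofReal (by positivity),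
    ENNReal.toReal_ofReal (by positivity), measureReal_def]
  simp
  field_simp

/-! ### The horocycle measure of an embedded box -/

/-- The times at which a translate of the closed horocycle of period `1 / y` is in a box. -/
def hittingTimes (x : SL(2, ℝ)) (a b c y : ℝ) (γ : SL(2, ℤ)) : Set ℝ :=
  {t | modularMap γ * (diagMat (Real.log y) * upperMat t) ∈ standardBox x a b c}

lemma continuous_horocycle (y : ℝ) : Continuous fun t => diagMat (Real.log y) * upperMat t :=
  continuous_const.mul continuous_upperMat

lemma isClosed_hittingTimes (x : SL(2, ℝ)) (a b c y : ℝ) (γ : SL(2, ℤ)) :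
    IsClosed (hittingTimes x a b c y γ) :=
  (isCompact_standardBox x a b c).isClosed.preimage
    (continuous_const.mul (continuous_horocycle y))

/-- The first column of an integral matrix. -/
def firstColumn (γ : SL(2, ℤ)) : ℤ × ℤ := (γ 0 0, γ 1 0)

/-- The first column does not depend on `t`, and the coordinate `η` of the second column is affine
in `t` with slope `α`, so `|η| ≤ (a/2) α` cuts out an interval of length `a`. -/
lemma volume_hittingTimes {x : SL(2, ℝ)} {a b c y : ℝ} (hy : 0 < y) (γ : SL(2, ℤ)) :
    volume (hittingTimes x a b c y γ) =
      {γ | √y • latticePoint (firstColumn γ) ∈ boxSector x b c}.indicator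
        (fun _ => ENNReal.ofReal a) γ := by
  have hs : 0 < √y := Real.sqrt_pos.2 hy
  have hexp : Real.exp (Real.log y / 2) = √y := by
    rw [Real.sqrt_eq_rpow, Real.rpow_def_of_pos hy]
    congr 1; ring
  have hmem : ∀ t, t ∈ hittingTimes x a b c y γ ↔
      √y • latticePoint (firstColumn γ) ∈ boxSector x b c ∧
      |t * (√y * (x 1 1 * γ 0 0 - x 0 1 * γ 1 0)) + (√y)⁻¹ * (x 1 1 * γ 0 1 - x 0 1 * γ 1 1)| ≤
        a / 2 * (√y * (x 1 1 * γ 0 0 - x 0 1 * γ 1 0)) := by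
    intro t
    change modularMap γ * (diagMat (Real.log y) * upperMat t) ∈ standardBox x a b c ↔ _
    obtain ⟨a1, a2, a3, a4⟩ := upperMat_entries t
    obtain ⟨c1, c2, c3, c4⟩ := diagMat_entries (Real.log y)
    rw [Real.exp_neg] at c4
    rw [hexp] at c1 c4
    rw [mem_standardBox_iff]
    simp only [mul_entry, modularMap_apply, a1, a2, a3, a4, c1, c2, c3, c4]
    refine and_congr (Iff.of_eq ?_) (Iff.of_eq ?_)
    · congr 1
      ext <;> simp [firstColumn, latticePoint, mul_comm]
    · congr 2 <;> ring
  by_cases h : √y • latticePoint (firstColumn γ) ∈ boxSector x b c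
  · rw [indicator_of_mem (by exact h)]
    have hα : 0 < √y * (x 1 1 * γ 0 0 - x 0 1 * γ 1 0) := by
      have := (Real.exp_pos _).trans_le h.1
      simp only [firstColumn, latticePoint, Prod.smul_fst, Prod.smul_snd, smul_eq_mul] at this
      linarith
    set α := √y * (x 1 1 * γ 0 0 - x 0 1 * γ 1 0)
    set η := (√y)⁻¹ * (x 1 1 * γ 0 1 - x 0 1 * γ 1 1)
    have hset : hittingTimes x a b c y γ = Icc (-(η / α) - a / 2) (-(η / α) + a / 2) := by
      ext t
      rw [hmem]
      simp only [h, true_and, mem_Icc]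
      have e : t * α + η = (t + η / α) * α := by field_simp
      rw [e, abs_mul, abs_of_pos hα, mul_le_mul_iff_left₀ hα, abs_le]
      constructor <;> rintro ⟨h1, h2⟩ <;> constructor <;> linarith
    rw [hset, Real.volume_Icc]
    congr 1; ring
  · have : hittingTimes x a b c y γ = ∅ := by
      ext t
      rw [hmem]
      simp [h]
    rw [this, measure_empty, indicator_of_notMem (by exact h)]

/-- The reason is the relation `T^k a_{log y} n_t = a_{log y} n_{t + k/y}`, which also shows that
the period is `1/y`. -/
lemma mem_hittingTimes_mul_T_zpow {x : SL(2, ℝ)} {a b c y : ℝ} (hy : 0 < y) (γ : SL(2, ℤ)) (k : ℤ)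
    (t : ℝ) : t ∈ hittingTimes x a b c y (γ * ModularGroup.T ^ k) ↔
      t + k * (1 / y) ∈ hittingTimes x a b c y γ := by
  have hs : 0 < √y := Real.sqrt_pos.2 hy
  have hexp : Real.exp (Real.log y / 2) = √y := by
    rw [Real.sqrt_eq_rpow, Real.rpow_def_of_pos hy]
    congr 1; ring
  have h : modularMap (ModularGroup.T ^ k) * (diagMat (Real.log y) * upperMat t) =
      diagMat (Real.log y) * upperMat (t + k * (1 / y)) := by
    obtain ⟨a1, a2, a3, a4⟩ := upperMat_entries t
    obtain ⟨b1, b2, b3, b4⟩ := upperMat_entries (t + k * (1 / y))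
    obtain ⟨c1, c2, c3, c4⟩ := diagMat_entries (Real.log y)
    rw [Real.exp_neg] at c4
    rw [hexp] at c1 c4
    apply sl_ext <;>
      simp only [mul_entry, modularMap_apply, a1, a2, a3, a4, b1, b2, b3, b4, c1, c2, c3, c4] <;>
      simp [ModularGroup.coe_T_zpow]
    have : √y * √y = y := Real.mul_self_sqrt hy.le
    field_simp
    linear_combination (k : ℝ) * (-1) * this
  change modularMap (γ * ModularGroup.T ^ k) * (diagMat (Real.log y) * upperMat t) ∈ standardBox x a b c ↔
    modularMap γ * (diagMat (Real.log y) * upperMat (t + k * (1 / y))) ∈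
      standardBox x a b c
  rw [map_mul, mul_assoc, h]

/-- Unfolding: the translates of a set of times by the multiples of the period `p` tile it. -/
lemma tsum_volume_translate_inter {J : Set ℝ} (hJ : MeasurableSet J) {p : ℝ} (hp : 0 < p) :
    ∑' k : ℤ, volume ((fun t => t + k * p) ⁻¹' J ∩ Ioc 0 p) = volume J := by
  have h1 : ∀ k : ℤ, volume ((fun t => t + k * p) ⁻¹' J ∩ Ioc 0 p) =
      volume (J ∩ Ioc (k • p) ((k + 1) • p)) := by
    intro k
    rw [← measure_preimage_add_right volume (k * p) (J ∩ Ioc (k • p) ((k + 1) • p))]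
    congr 1
    ext t
    simp only [mem_inter_iff, mem_preimage, mem_Ioc, zsmul_eq_mul]
    push_cast
    refine and_congr Iff.rfl ⟨fun h => ⟨?_, ?_⟩, fun h => ⟨?_, ?_⟩⟩ <;> linarith [h.1, h.2]
  simp_rw [h1]
  rw [← measure_iUnion]
  · rw [← inter_iUnion, iUnion_Ioc_zsmul hp, inter_univ]
  · intro i j hij
    exact (pairwise_disjoint_Ioc_zsmul p hij).mono inter_subset_right inter_subset_right
  · intro k
    exact hJ.inter measurableSet_Ioc

/-- The integral matrices with the same first column as `γ₀` are the `γ₀ T ^ k`. -/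
def zpowEquivFiber (γ₀ : SL(2, ℤ)) : ℤ ≃ {γ : SL(2, ℤ) // firstColumn γ = firstColumn γ₀} := by
  refine Equiv.ofBijective (fun k => ⟨γ₀ * ModularGroup.T ^ k, ?_⟩) ⟨?_, ?_⟩
  · simp [firstColumn, Matrix.mul_apply, Fin.sum_univ_two, ModularGroup.coe_T_zpow]
  · intro k l h
    have h1 := mul_left_cancel (Subtype.ext_iff.1 h)
    have h2 := congrArg (fun γ : SL(2, ℤ) => γ 0 1) h1
    simpa [ModularGroup.coe_T_zpow] using h2
  · rintro ⟨γ, hγ⟩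
    have hdet := γ.det_coe
    have hdet₀ := γ₀.det_coe
    rw [Matrix.det_fin_two] at hdet hdet₀
    simp only [firstColumn, Prod.mk.injEq] at hγ
    obtain ⟨h0, h1⟩ := hγ
    rw [h0, h1] at hdet
    -- The exponent is the upper right entry of `γ₀⁻¹ γ`.
    refine ⟨γ₀ 1 1 * γ 0 1 - γ₀ 0 1 * γ 1 1, Subtype.ext ?_⟩
    ext i j
    fin_cases i <;> fin_cases j <;>
      simp [Matrix.mul_apply, Fin.sum_univ_two, ModularGroup.coe_T_zpow, h0, h1]
    · linear_combination γ 0 1 * hdet₀ - γ₀ 0 1 * hdet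
    · linear_combination γ 1 1 * hdet₀ - γ₀ 1 1 * hdet

/-- A primitive column has a fibre `{γ₀ T^k}`, whose hitting times within one period reassemble the
whole interval of `γ₀`; a nonprimitive column has an empty fibre. -/
lemma tsum_fiber_volume_hittingTimes {x : SL(2, ℝ)} {a b c y : ℝ} (hy : 0 < y) (v : ℤ × ℤ) :
    ∑' γ : {γ : SL(2, ℤ) // firstColumn γ = v},
      volume (hittingTimes x a b c y γ.1 ∩ Ioc 0 (1 / y)) =
      {v : ℤ × ℤ | IsCoprime v.1 v.2 ∧ √y • latticePoint v ∈ boxSector x b c}.indicator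
        (fun _ => ENNReal.ofReal a) v := by
  classical
  by_cases hv : IsCoprime v.1 v.2
  · obtain ⟨γ₀, h0, h1⟩ := hv.exists_SL2_col 0
    obtain rfl : firstColumn γ₀ = v := Prod.ext h0 h1
    rw [← (zpowEquivFiber γ₀).tsum_eq]
    have hk : ∀ k : ℤ, hittingTimes x a b c y ((zpowEquivFiber γ₀ k).1) =
        (fun t => t + k * (1 / y)) ⁻¹' hittingTimes x a b c y γ₀ := by
      intro k
      ext t
      exact mem_hittingTimes_mul_T_zpow hy γ₀ k t
    simp_rw [hk]
    rw [tsum_volume_translate_inter (isClosed_hittingTimes x a b c y γ₀).measurableSet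
      (one_div_pos.2 hy), volume_hittingTimes hy, indicator_apply, indicator_apply]
    exact if_congr (and_iff_right hv).symm rfl rfl
  · have hempty : IsEmpty {γ : SL(2, ℤ) // firstColumn γ = v} := by
      refine ⟨fun γ => hv ?_⟩
      rw [← γ.2]
      exact γ.1.isCoprime_col 0
    rw [tsum_empty, indicator_of_notMem]
    exact fun h => hv h.1

theorem horocycleMeasure_real_box {x : SL(2, ℝ)} {a b c y : ℝ} (ha : 0 < a) (hy : 0 < y)
    (hinj : InjOn proj (standardBox x a b c))
    (hfin : {v : ℤ × ℤ | √y • latticePoint v ∈ boxSector x b c}.Finite) :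
    (horocycleMeasure y).real (proj '' standardBox x a b c) =
      y * (a * {v : ℤ × ℤ | IsCoprime v.1 v.2 ∧ √y • latticePoint v ∈ boxSector x b c}.ncard) := by
  have hclosed := isClosed_proj_image (isCompact_standardBox x a b c)
  have hcont : Continuous fun t : ℝ => proj (unstableFlow t (diagMat (Real.log y))) :=
    continuous_proj.comp (continuous_horocycle y)
  have hset : (fun t : ℝ => proj (unstableFlow t (diagMat (Real.log y)))) ⁻¹'
      (proj '' standardBox x a b c) = ⋃ γ, hittingTimes x a b c y γ := by
    change (fun t => diagMat (Real.log y) * upperMat t) ⁻¹'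
      (proj ⁻¹' (proj '' standardBox x a b c)) = _
    rw [proj_preimage_image, preimage_iUnion]
    rfl
  have hvol : volume ((⋃ γ, hittingTimes x a b c y γ) ∩ Ioc 0 (1 / y)) = ENNReal.ofReal a *
      {v : ℤ × ℤ | IsCoprime v.1 v.2 ∧ √y • latticePoint v ∈ boxSector x b c}.ncard := by
    set V := {v : ℤ × ℤ | IsCoprime v.1 v.2 ∧ √y • latticePoint v ∈ boxSector x b c} with hV
    have hVfin : V.Finite := hfin.subset fun v hv => hv.2
    rw [iUnion_inter, measure_iUnion]
    · rw [← (Equiv.sigmaFiberEquiv firstColumn).tsum_eq, ENNReal.tsum_sigma']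
      simp only [Equiv.sigmaFiberEquiv_apply]
      simp_rw [tsum_fiber_volume_hittingTimes hy]
      rw [tsum_eq_sum (s := hVfin.toFinset) fun v hv =>
          indicator_of_notMem (fun h => hv (hVfin.mem_toFinset.2 h)) _,
        Finset.sum_congr rfl fun v hv => indicator_of_mem (hVfin.mem_toFinset.1 hv) _, Finset.sum_const,
        nsmul_eq_mul, mul_comm, ncard_eq_toFinset_card _ hVfin]
    · intro γ γ' hne
      refine disjoint_left.2 fun t ht ht' => hne ?_
      exact eq_of_modularMap_mul_mem hinj ht.1 ht'.1
    · intro γ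
      exact (isClosed_hittingTimes x a b c y γ).measurableSet.inter measurableSet_Ioc
  rw [measureReal_def, horocycleMeasure, Measure.smul_apply,
    Measure.map_apply hcont.measurable hclosed.measurableSet,
    -- The half-open period is the one whose translates tile the line.
    ← Measure.restrict_congr_set Ioc_ae_eq_Icc,
    Measure.restrict_apply (hcont.measurable hclosed.measurableSet), hset, hvol, smul_eq_mul,
    ENNReal.toReal_mul, ENNReal.toReal_mul, ENNReal.toReal_ofReal hy.le,
    ENNReal.toReal_ofReal ha.le, ENNReal.toReal_natCast]

/-! ### Comparison of the two measures and uniformity -/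

/-- Equidistribution of long closed horocycles for one embedded box, with an error term depending
only on bounds for the size of the box. -/
lemma abs_horocycleMeasure_sub_haarProb_le {ρ κ : ℝ}
    (hκ : ∀ (p q : ℝ × ℝ), p.1 * q.2 - p.2 * q.1 = 1 → ∀ r₀ r₁ k : ℝ, 0 < r₀ → r₀ < r₁ →
      0 < k → (∀ z ∈ sector p q r₀ r₁ k, |z.1| ≤ ρ ∧ |z.2| ≤ ρ) → ∀ T : ℝ, 0 < T → 2 ≤ T ^ 2 →
      |({v : ℤ × ℤ | IsCoprime v.1 v.2 ∧
        latticePoint v ∈ sector p q (T * r₀) (T * r₁) k}.ncard : ℝ) -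
        T ^ 2 * (volume.real (sector p q r₀ r₁ k) * (6 / Real.pi ^ 2))| ≤ κ * (T * Real.log T))
    {x : SL(2, ℝ)} {a b c y : ℝ} (ha : 0 < a) (hb : 0 < b) (hc : 0 < c)
    (hinj : InjOn proj (standardBox x a b c))
    (hρ : ∀ z ∈ boxSector x b c, |z.1| ≤ ρ ∧ |z.2| ≤ ρ) (hy : 0 < y) (hy2 : y ≤ 1 / 2) :
    |(horocycleMeasure y).real (proj '' standardBox x a b c) -
      haarProb.real (proj '' standardBox x a b c)| ≤ a * κ * (√y * -Real.log y) / 2 := by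
  have hx := sl_det x
  have hs : 0 < √y := Real.sqrt_pos.2 hy
  have hss : √y ^ 2 = y := Real.sq_sqrt hy.le
  -- With this dilation, `y ≤ 1/2` is the requirement `T² ≥ 2`, and `log T = -(log y)/2` yields the
  -- factor `1/2` in the bound.
  set T := (√y)⁻¹ with hT
  have hT0 : 0 < T := inv_pos.2 hs
  have hT2 : T ^ 2 = y⁻¹ := by rw [hT, inv_pow, hss]
  have hT2' : 2 ≤ T ^ 2 := by
    rw [hT2, le_inv_comm₀ two_pos hy]
    linarith
  have hlogT : Real.log T = -Real.log y / 2 := by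
    rw [hT, Real.log_inv, Real.log_sqrt hy.le]
    ring
  have hpq : ((x 0 0, x 1 0) : ℝ × ℝ).1 * ((x 0 1, x 1 1) : ℝ × ℝ).2 -
      ((x 0 0, x 1 0) : ℝ × ℝ).2 * ((x 0 1, x 1 1) : ℝ × ℝ).1 = 1 := by
    simp only
    linarith
  have hexp : Real.exp (-(b / 4)) < Real.exp (b / 4) := Real.exp_lt_exp.2 (by linarith)
  have hmem : ∀ v : ℤ × ℤ, √y • latticePoint v ∈ boxSector x b c ↔ latticePoint v ∈
      sector (x 0 0, x 1 0) (x 0 1, x 1 1) (T * Real.exp (-(b / 4))) (T * Real.exp (b / 4))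
        (c / 2) := by
    intro v
    rw [boxSector, ← smul_mem_sector_iff hT0, hT, inv_smul_smul₀ hs.ne']
  have hcount := hκ _ _ hpq _ _ _ (Real.exp_pos _) hexp (half_pos hc) hρ T hT0 hT2'
  have hfin := (abs_ncard_latticePoint_sector_sub_le hpq (Real.exp_pos _) hexp (half_pos hc) hT0
    hρ).1
  rw [horocycleMeasure_real_box ha hy hinj (by simp_rw [hmem]; exact hfin),
    haarProb_real_box ha hinj]
  simp_rw [hmem]
  rw [hlogT, hT2] at hcount
  set N : ℝ := ({v : ℤ × ℤ | IsCoprime v.1 v.2 ∧ latticePoint v ∈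
    sector (x 0 0, x 1 0) (x 0 1, x 1 1) (T * Real.exp (-(b / 4))) (T * Real.exp (b / 4))
      (c / 2)}.ncard : ℝ)
  change |N - y⁻¹ * (volume.real (boxSector x b c) * (6 / Real.pi ^ 2))| ≤ _ at hcount
  set V := volume.real (boxSector x b c) * (6 / Real.pi ^ 2)
  have e : y * (a * N) - a * V = y * a * (N - y⁻¹ * V) := by
    field_simp
  rw [e, abs_mul, abs_of_pos (mul_pos hy ha)]
  refine (mul_le_mul_of_nonneg_left hcount (mul_pos hy ha).le).trans_eq ?_
  have hyT : y * T = √y := by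
    rw [hT]
    nth_rewrite 1 [← hss]
    field_simp
  linear_combination a * κ * (-Real.log y / 2) * hyT

lemma exists_boxSector_bound (x : SL(2, ℝ)) (b c : ℝ) :
    ∃ ρ : ℝ, ∀ z ∈ boxSector x b c, |z.1| ≤ ρ ∧ |z.2| ≤ ρ := by
  have hx := sl_det x
  set E := Real.exp (b / 4) with hE
  have hE0 : 0 < E := Real.exp_pos _
  have key : ∀ p q α β : ℝ, |α| ≤ E → |β| ≤ |c| * E → |α * p + β * q| ≤ E * |p| + |c| * E * |q| :=
    fun p q α β hα hβ => (abs_add_le _ _).trans (by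
      rw [abs_mul, abs_mul]
      gcongr)
  refine ⟨max (E * |x 0 0| + |c| * E * |x 0 1|) (E * |x 1 0| + |c| * E * |x 1 1|), ?_⟩
  rintro z ⟨h0, h1, h2⟩
  simp only at h0 h1 h2
  set α := z.1 * x 1 1 - z.2 * x 0 1 with hα
  set β := x 0 0 * z.2 - x 1 0 * z.1 with hβ
  have hα0 : 0 < α := (Real.exp_pos _).trans_le h0
  have hαE : |α| ≤ E := by rwa [abs_of_pos hα0]
  have hβE : |β| ≤ |c| * E := h2.trans (mul_le_mul (by linarith [le_abs_self c, abs_nonneg c]) h1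
    hα0.le (abs_nonneg c))
  have e1 : z.1 = α * x 0 0 + β * x 0 1 := by
    rw [hα, hβ]; linear_combination (-z.1) * hx
  have e2 : z.2 = α * x 1 0 + β * x 1 1 := by
    rw [hα, hβ]; linear_combination (-z.2) * hx
  constructor
  · rw [e1]
    exact (key _ _ _ _ hαE hβE).trans (le_max_left _ _)
  · rw [e2]
    exact (key _ _ _ _ hαE hβE).trans (le_max_right _ _)

end ModularHorocycle

end

open ModularHorocycle

theorem theorem3p18 (C : Set ModularHorocycle.ModularBundle)
    (hC : ModularHorocycle.IsAdaptedBox C) :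
    ∃ k : ℝ, 0 < k ∧ ∀ C' : Set ModularHorocycle.ModularBundle, C' ⊆ C →
      ModularHorocycle.IsAdaptedBox C' →
        ∃ K : ℝ → ℝ, ∀ y : ℝ, 0 < y → y ≤ 1 / 2 →
          (ModularHorocycle.horocycleMeasure y).real C' =
              ModularHorocycle.haarProb.real C' + K y * y ^ (1 / 2 : ℝ) * Real.log y ∧
            |K y| ≤ k := by
  obtain ⟨x, a, b, c, ha, hb, hc, hinj, rfl, -⟩ := hC
  obtain ⟨ρ, hρ⟩ := exists_boxSector_bound x b c
  obtain ⟨κ, hκ0, hκ⟩ := exists_abs_ncard_primitive_sub_le ρ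
  -- Here `κ` depends only on the square of half-side `ρ` holding the trapezoid of `C`, and `a`
  -- bounds the width of every smaller box.
  refine ⟨a * κ, mul_pos ha hκ0, ?_⟩
  rintro _ hsub ⟨x₁, a', b', c', ha', hb', hc', hinj₁, rfl, -⟩
  obtain ⟨x', hsub', hinj', himage⟩ := exists_translate_standardBox_subset ha'.le hb'.le hc'.le
    hinj hinj₁ hsub
  rw [← himage]
  -- The function `K` is forced to be this quotient; its denominator is nonzero because `log y < 0`
  -- for `y ≤ 1/2`.
  refine ⟨fun y => ((horocycleMeasure y).real (proj '' standardBox x' a' b' c') -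
    haarProb.real (proj '' standardBox x' a' b' c')) / (√y * Real.log y), fun y hy hy2 => ?_⟩
  have hs : 0 < √y := Real.sqrt_pos.2 hy
  have hlog : Real.log y < 0 := Real.log_neg hy (by linarith)
  have hne : √y * Real.log y ≠ 0 := mul_ne_zero hs.ne' hlog.ne
  refine ⟨?_, ?_⟩
  · rw [← Real.sqrt_eq_rpow, mul_assoc, div_mul_cancel₀ _ hne]
    ring
  · have h := abs_horocycleMeasure_sub_haarProb_le hκ ha' hb' hc' hinj'
      (fun z hz => hρ z (boxSector_subset_of_standardBox_subset ha'.le hsub' hz)) hy hy2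
    have haa := le_of_standardBox_subset ha'.le hb'.le hc'.le hsub'
    have hpos : 0 < √y * -Real.log y := mul_pos hs (neg_pos.2 hlog)
    rw [abs_div, abs_mul, abs_of_pos hs, abs_of_neg hlog, div_le_iff₀ hpos]
    refine h.trans ?_
    have h1 : a' * κ * (√y * -Real.log y) ≤ a * κ * (√y * -Real.log y) := by gcongr
    have h2 : 0 < a * κ * (√y * -Real.log y) := by positivity
    linarith
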